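/- \textbf{Setting.} Let $\mathbf z_1,\mathbf z_2,\dots$ be a stochastic process in a measurable space $\mathcal Z$, with (regular) conditional distributions $P_t=\mathbb P(\mathbf z_{t+1}\in\cdot\mid \mathbf z_{1:t})$. Let $\mathcal D$ be a convex subset of a real vector space, let the loss $\ell:\mathcal D\times\mathcal Z\to[0,1]$ be measurable and convex in its first argument, let $\mathcal H$ be a non-empty class of measurable functions $h:\mathcal Z\to\mathcal D$, and write $\ell(h,z)=\ell(h(z),z)$ and $\mathcal L(\mathcal H)=\{\ell(h,\cdot):h\in\mathcal H\}$. As a measurability condition, assume that $\mathcal L(\mathcal H)$ is pointwise separable: it has a countable subset such that every element of $\mathcal L(\mathcal H)$ is the pointwise limit of a sequence from this subset. The conditional risk is $R_t(h)=\int \ell(h,y)\,P_t(dy)$, and $d_{i,j}=\sup_{h\in\mathcal H}|R_{i-1}(h)-R_{j-1}(h)|$ for $i,j\ge1$. Assume that $d_{i,j}\le M_{i,j}$ almost surely, for all $i,j$, where $M_{i,j}$ is a measurable function of the observations $\mathbf z_{1:\max(i,j)-1}$. \textbf{Algorithm.} MACRO with threshold $\varepsilon\ge0$ maintains a list of subroutines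 $1,\dots,N$ (initially $N=0$) with creation times $\tau_1,\dots,\tau_N$. At time $t=1,2,\dots$ it forms $J=\{j\le N: M_{t,\tau_j}\le\varepsilon\}$; if $J=\emptyset$, it creates a new subroutine $N+1$ with $\tau_{N+1}=t$ and puts $J=\{N+1\}$. If $J$ consists of existing subroutines, the active subroutine is some $j\in J$ that minimizes $M_{t,\tau_j}$; otherwise it is the new one. Then $\mathbf z_t$ is observed and all subroutines in $J$ are updated with it. Let $t_{j,1}<t_{j,2}<\dots$ be the times at which subroutine $j$ is updated, and $s_{j,n}$ the number of them that are $\le n$. Each subroutine runs an online learning algorithm; $h_{j,i}\in\mathcal H$ denotes its hypothesis after $i$ updates, a measurable function of the $i$ points it was updated with. Its regret is $$W_{j,n}=\sum_{i=1}^{s_{j,n}}\ell(h_{j,i-1},\mathbf z_{t_{j,i}})-\inf_{h\in\mathcal H}\sum_{i=1}^{s_{j,n}}\ell(h,\mathbf z_{t_{j,i}}).$$ Let $I_n$ be the index of the subroutine that is active once $\mathbf z_{1:n}$ has been observed (the one chosen at time $n+1$, before $\mathbf z_{n+1}$ is observed), and let the output be the average $h_n=\frac1{s_{I_n,n}}\sum_{i=1}^{s_{I_n,n}}h_{I_n,i}$.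 For $k,m\ge1$ let $$E_{k,m}=\Big\{|\operatorname{supp} I_n|\le k\ \wedge\ \min_{j\in\operatorname{supp}I_n}s_{j,n}\ge m\Big\},\qquad \operatorname{supp}I_n=\{j:\mathbb P(I_n=j)>0\}.$$ \textbf{Covering numbers.} A tree of depth $n$ with values in $X$ is a sequence of maps $x_t:\{\pm1\}^{t-1}\to X$, $1\le t\le n$; write $x_t(e)=x_t(e_1,\dots,e_{t-1})$. A set $C$ of real-valued trees of depth $n$ is a $\beta$-cover of $\mathcal F\subseteq\mathbb R^{\mathcal Z}$ on a $\mathcal Z$-valued tree $x$ if for all $f\in\mathcal F$ and $e\in\{\pm1\}^n$ there is $v\in C$ with $\max_{t\le n}|f(x_t(e))-v_t(e)|\le\beta$. $\mathcal N_\infty(\mathcal F,\beta,n)\in\mathbb N\cup\{\infty\}$ is the supremum over all $\mathcal Z$-valued trees $x$ of depth $n$ of the smallest cardinality of such a cover. \textbf{Theorem.} For all $n$, all $k,m\ge1$, all $\alpha\in[0,1]$ and $\beta\in[0,\alpha/8]$, $$\mathbb P\Big(R_n(h_n)-\inf_{h\in\mathcal H}R_n(h)>\alpha+\frac{W_{I_n,n}}{s_{I_n,n}}+4\varepsilon\Big)\le\frac{4k\,\mathcal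 N_\infty(\mathcal L(\mathcal H),\beta,n)}{(\alpha/2-4\beta)^2}\,e^{-\frac12 m(\alpha/2-4\beta)^2}+\mathbb P(E_{k,m}^c),$$ where the right-hand side is $+\infty$ if $\beta=\alpha/8$ or the covering number is infinite. -/

import Mathlib

open MeasureTheory ProbabilityTheory Filter Topology
open scoped ENNReal

namespace Macro

/-! ### Sequential covering numbers -/

/-- An `X`-valued tree of depth `n`: the node at level `t` is indexed by the first `t` signs of a
path, i.e. the tree is a sequence of maps `{±1}^t → X`, `t = 0, …, n - 1` (signs are booleans). -/
abbrev SeqTree (X : Type*) (n : ℕ) : Type _ := (t : Fin n) → (Fin t → Bool) → X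

/-- The value of a tree at level `t` along the path `e`. -/
def SeqTree.along {X : Type*} {n : ℕ} (x : SeqTree X n) (e : Fin n → Bool) (t : Fin n) : X :=
  x t (fun i => e (Fin.castLE t.isLt.le i))

/-- `C` is a sequential `θ`-cover, in the sup norm, of the function class `F` on the tree `x`. -/
def IsSeqCover {Z : Type*} {n : ℕ} (F : Set (Z → ℝ)) (θ : ℝ) (x : SeqTree Z n)
    (C : Set (SeqTree ℝ n)) : Prop :=
  ∀ f ∈ F, ∀ e : Fin n → Bool, ∃ v ∈ C, ∀ t : Fin n, |f (x.along e t) - v.along e t| ≤ θ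

/-- The sequential `θ`-covering number of `F` on the tree `x` (`⊤` if there is no finite cover). -/
noncomputable def seqCoveringNumberOn {Z : Type*} {n : ℕ} (F : Set (Z → ℝ)) (θ : ℝ)
    (x : SeqTree Z n) : ℕ∞ :=
  ⨅ (C : Set (SeqTree ℝ n)) (_ : IsSeqCover F θ x C), C.encard

/-- The maximal sequential `θ`-covering number of `F` over all trees of depth `n`. -/
noncomputable def seqCoveringNumber {Z : Type*} (F : Set (Z → ℝ)) (θ : ℝ) (n : ℕ) : ℕ∞ :=
  ⨆ x : SeqTree Z n, seqCoveringNumberOn F θ x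

/-! ### Loss class, conditional risk, discrepancy -/

/-- The induced class `L(H) = {z ↦ ℓ (h z) z | h ∈ H}`. -/
def lossClass {Z V : Type*} (ℓ : V → Z → ℝ) (H : Set (Z → V)) : Set (Z → ℝ) :=
  (fun h z => ℓ (h z) z) '' H

/-- Measurability condition on a function class: some countable subclass is
pointwise sequentially dense in it. -/
def PointwiseSeparable {Z : Type*} (F : Set (Z → ℝ)) : Prop :=
  ∃ F₀ ⊆ F, F₀.Countable ∧ ∀ f ∈ F, ∃ u : ℕ → Z → ℝ,
    (∀ k, u k ∈ F₀) ∧ ∀ z, Tendsto (fun k => u k z) atTop (𝓝 (f z))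

/-- The first `t` observations. The observations are numbered `z 0, z 1, z 2, …`, so that `z t` is
the observation that follows the history `hist z t ω`. -/
def hist {Ω Z : Type*} (z : ℕ → Ω → Z) (t : ℕ) (ω : Ω) : Fin t → Z := fun i => z i ω

/-- The conditional risk of `h` after `t` observations: the expected loss on the next observation,
`κ t` being the conditional distribution of `z t` given the first `t` observations. -/
noncomputable def risk {Ω Z V : Type*} [MeasurableSpace Z] (ℓ : V → Z → ℝ) (z : ℕ → Ω → Z)
    (κ : (t : ℕ) → Kernel (Fin t → Z) Z) (t : ℕ) (h : Z → V) (ω : Ω) : ℝ :=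
  ∫ y, ℓ (h y) y ∂(κ t (hist z t ω))

/-- The discrepancy between the conditional distributions of the observations `z i` and `z j`. -/
noncomputable def discrepancy {Ω Z V : Type*} [MeasurableSpace Z] (ℓ : V → Z → ℝ) (H : Set (Z → V))
    (z : ℕ → Ω → Z) (κ : (t : ℕ) → Kernel (Fin t → Z) Z) (i j : ℕ) (ω : Ω) : ℝ :=
  ⨆ h : H, |risk ℓ z κ i h ω - risk ℓ z κ j h ω|

/-! ### The meta-algorithm

Rounds are numbered `0, 1, 2, …`; in round `t` the first `t` observations are available and a
hypothesis for `z t` is chosen; then `z t` is observed and the subroutines are updated.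
Subroutines are numbered `0, 1, 2, …` in the order of their creation. Which
subroutines are created and updated in which round is determined by the threshold `ε` and the
values `a i j` of the discrepancy bounds along the realization. -/

open Classical in
/-- The list of the creation rounds of the subroutines that exist at the beginning of round `t`.
A new subroutine is created in round `t` iff no existing one is `ε`-close. -/
noncomputable def starts (a : ℕ → ℕ → ℝ) (ε : ℝ) : ℕ → List ℕ
  | 0 => []
  | t + 1 => if ∃ τ ∈ starts a ε t, a t τ ≤ ε then starts a ε t else starts a ε t ++ [t]

/-- The number of subroutines that exist at the beginning of round `t`. -/
noncomputable def numSub (a : ℕ → ℕ → ℝ) (ε : ℝ) (t : ℕ) : ℕ := (starts a ε t).length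

/-- The bound between round `t` and the creation round of subroutine `j`
(meaningful for `j < numSub a ε t`). -/
noncomputable def dist (a : ℕ → ℕ → ℝ) (ε : ℝ) (t j : ℕ) : ℝ := a t ((starts a ε t).getD j 0)

open Classical in
/-- The existing subroutines that are `ε`-close in round `t`. -/
noncomputable def close (a : ℕ → ℕ → ℝ) (ε : ℝ) (t : ℕ) : Finset ℕ :=
  {j ∈ Finset.range (numSub a ε t) | dist a ε t j ≤ ε}

open Classical in
/-- The subroutines updated with `z t` in round `t`: the `ε`-close ones, or, if there is none,
the newly created one. -/
noncomputable def updated (a : ℕ → ℕ → ℝ) (ε : ℝ) (t : ℕ) : Finset ℕ :=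
  if (close a ε t).Nonempty then close a ε t else {numSub a ε t}

/-- `j` is an admissible choice of the active subroutine in round `t`: an `ε`-close one with the
smallest discrepancy bound (ties broken arbitrarily), or, if there is no `ε`-close one, the newly
created one. -/
def IsActive (a : ℕ → ℕ → ℝ) (ε : ℝ) (t j : ℕ) : Prop :=
  j ∈ updated a ε t ∧ ((close a ε t).Nonempty → ∀ i ∈ close a ε t, dist a ε t j ≤ dist a ε t i)

open Classical in
/-- The number of updates of subroutine `j` with the first `n` observations. -/
noncomputable def numUpd (a : ℕ → ℕ → ℝ) (ε : ℝ) (j n : ℕ) : ℕ :=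
  ({t ∈ Finset.range n | j ∈ updated a ε t}).card

/-- The round in which subroutine `j` is updated for the `(i + 1)`-st time. -/
noncomputable def updTime (a : ℕ → ℕ → ℝ) (ε : ℝ) (j i : ℕ) : ℕ :=
  Nat.nth (fun t => j ∈ updated a ε t) i

/-- The hypothesis of subroutine `j` after `i` updates. Here `A j i x` is the hypothesis that the
`j`-th online learning algorithm produces after the `i` data points `x`. -/
noncomputable def hyp {Ω Z V : Type*} (A : ℕ → (i : ℕ) → (Fin i → Z) → Z → V) (z : ℕ → Ω → Z)
    (M : ℕ → ℕ → Ω → ℝ) (ε : ℝ) (j i : ℕ) (ω : Ω) : Z → V :=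
  A j i (fun l => z (updTime (fun p q => M p q ω) ε j l) ω)

/-- `s_{j,n}`: the number of updates of subroutine `j` with the first `n` observations. -/
noncomputable def updates {Ω : Type*} (M : ℕ → ℕ → Ω → ℝ) (ε : ℝ) (j n : ℕ) (ω : Ω) : ℕ :=
  numUpd (fun p q => M p q ω) ε j n

/-- `W_{j,n}`: the regret of subroutine `j` over its updates with the first `n` observations;
each point is predicted with the hypothesis held just before the update with that point. -/
noncomputable def regret {Ω Z V : Type*} (ℓ : V → Z → ℝ) (H : Set (Z → V))
    (A : ℕ → (i : ℕ) → (Fin i → Z) → Z → V) (z : ℕ → Ω → Z) (M : ℕ → ℕ → Ω → ℝ) (ε : ℝ)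
    (j n : ℕ) (ω : Ω) : ℝ :=
  let pt : ℕ → Z := fun i => z (updTime (fun p q => M p q ω) ε j i) ω
  ∑ i ∈ Finset.range (updates M ε j n ω), ℓ (hyp A z M ε j i ω (pt i)) (pt i)
    - ⨅ h : H, ∑ i ∈ Finset.range (updates M ε j n ω), ℓ ((h : Z → V) (pt i)) (pt i)

/-- The averaged output of subroutine `j` after `n` observations: the mean of the hypotheses
it produced after its 1st, …, `s_{j,n}`-th update. -/
noncomputable def avgHyp {Ω Z V : Type*} [AddCommGroup V] [Module ℝ V]
    (A : ℕ → (i : ℕ) → (Fin i → Z) → Z → V) (z : ℕ → Ω → Z) (M : ℕ → ℕ → Ω → ℝ) (ε : ℝ)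
    (j n : ℕ) (ω : Ω) : Z → V :=
  ((updates M ε j n ω : ℝ)⁻¹) • ∑ i ∈ Finset.Icc 1 (updates M ε j n ω), hyp A z M ε j i ω

/-- The support of an integer valued random variable. -/
def supp {Ω : Type*} [MeasurableSpace Ω] (μ : Measure Ω) (I : Ω → ℕ) : Set ℕ :=
  {j | μ {ω | I ω = j} ≠ 0}

/-- The event `E_{k,m}`: the support of `I` has at most `k` elements, and all subroutines in it
have been updated at least `m` times. -/
def goodEvent {Ω : Type*} [MeasurableSpace Ω] (μ : Measure Ω) (M : ℕ → ℕ → Ω → ℝ) (ε : ℝ)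
    (I : Ω → ℕ) (n k m : ℕ) : Set Ω :=
  {ω | (supp μ I).encard ≤ k ∧ ∀ j ∈ supp μ I, m ≤ updates M ε j n ω}

end Macro

/-! Let `s` be the number of updates of the active subroutine. By convexity, the risk of the
averaged output is at most the average risk of the averaged hypotheses. Round `n` and every update
round of the subroutine are within `ε` of its creation round in discrepancy, so exchanging the
current risk for the conditional risks of the update rounds costs `2ε` per round, once for the
output and once for the competitor. What remains is to compare losses with conditional risks over
the update rounds: along the hypotheses of the subroutine (budget `s α / 4`) and uniformly over `H`
(budget `s α / 2`). The last `s α / 4` pays for an index shift. This bookkeeping is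
`excess_le_of_deviation_le`.

For fixed `j`, the history decides whether a round updates `j`, so both deviations are controlled by
exponential supermartingales that move only in the update rounds. Their compensator is charged per
update, so the random number of updates needs no union bound over its values; only the lower bound
`m` enters. For the subroutine's own hypotheses, Hoeffding's lemma suffices
(`measure_selSum_hoeffding_le`).

For the class, the supermartingale is `gameVal`, the worst exponential moment of the supremum over
all trees filling the remaining rounds, evaluated at the current deviations. The supermartingale
step is symmetrization with a ghost sample (`lintegral_gameVal_sym_le`), carried out on exponential
moments and not on probabilities. The initial value is at most the covering number: along each path
a cover replaces the supremum by a sum over the trees of the cover, and each of these has a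
compensated Rademacher moment of at most one (`sum_exp_predictable_le`, `treeVal_sym_le`). Markov's
inequality then gives `measure_exists_selSum_le`.

A union bound over the at most `k` indices in the support finishes the proof; in the degenerate
ranges of the parameters the right-hand side is at least one. -/

namespace Macro

/-! ### Rademacher sums with predictable coefficients -/

/-- The real number `±1` encoded by a boolean. -/
def sgn (b : Bool) : ℝ := if b then 1 else -1

@[simp] theorem sgn_true : sgn true = 1 := rfl

@[simp] theorem sgn_false : sgn false = -1 := rfl

/-- Predictability makes the first coefficient a constant, so the first sign can be averaged
separately: `cosh a ≤ exp (a ^ 2 / 2)` is exactly compensated. Once that sign is fixed, the other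
coefficients are predictable in the remaining signs. -/
theorem sum_exp_predictable_le (n : ℕ) (a : Fin n → (Fin n → Bool) → ℝ)
    (ha : ∀ t e e', (∀ i < t, e i = e' i) → a t e = a t e') :
    ∑ e, Real.exp (∑ t, (sgn (e t) * a t e - a t e ^ 2 / 2)) ≤ 2 ^ n := by
  induction n with
  | zero => simp
  | succ n ih =>
    rw [← (Fin.consEquiv (fun _ : Fin (n + 1) => Bool)).sum_comp, Fintype.sum_prod_type]
    set e₀ : Fin (n + 1) → Bool := fun _ => true
    have h0 : ∀ e, a 0 e = a 0 e₀ := fun e => ha 0 e e₀ (fun i hi => absurd hi (by simp))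
    have hb : ∀ b : Bool, ∑ e : Fin n → Bool,
        Real.exp (∑ t, (sgn ((Fin.consEquiv (fun _ : Fin (n + 1) => Bool)) (b, e) t)
          * a t ((Fin.consEquiv (fun _ : Fin (n + 1) => Bool)) (b, e))
          - a t ((Fin.consEquiv (fun _ : Fin (n + 1) => Bool)) (b, e)) ^ 2 / 2))
        ≤ Real.exp (sgn b * a 0 e₀ - a 0 e₀ ^ 2 / 2) * 2 ^ n := by
      intro b
      have := ih (fun t e => a t.succ (Fin.cons b e)) (fun t e e' h => ha _ _ _ (by
        intro i hi
        refine Fin.cases ?_ (fun i hi => ?_) i hi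
        · simp
        · simpa using h i (by simpa using hi)))
      refine le_trans (le_of_eq ?_)
        (mul_le_mul_of_nonneg_left this (Real.exp_pos _).le)
      rw [Finset.mul_sum]
      refine Finset.sum_congr rfl fun e _ => ?_
      rw [← Real.exp_add, Fin.sum_univ_succ, h0]
      rfl
    calc _ ≤ ∑ b, Real.exp (sgn b * a 0 e₀ - a 0 e₀ ^ 2 / 2) * 2 ^ n :=
          Finset.sum_le_sum fun b _ => hb b
      _ = 2 * (Real.cosh (a 0 e₀) * Real.exp (-(a 0 e₀ ^ 2 / 2))) * 2 ^ n := by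
          simp only [Fintype.sum_bool, sgn_true, sgn_false, Real.cosh_eq, sub_eq_add_neg,
            Real.exp_add]
          ring_nf
      _ ≤ 2 * 1 * 2 ^ n := by
          gcongr
          calc _ ≤ Real.exp (a 0 e₀ ^ 2 / 2) * Real.exp (-(a 0 e₀ ^ 2 / 2)) := by
                gcongr; exact Real.cosh_le_exp_half_sq _
            _ = 1 := by rw [← Real.exp_add]; simp
      _ = 2 ^ (n + 1) := by ring

/-! ### The value of a sequential game -/

section Game

variable {ι P : Type*} (u : P → ι → ℝ) (c : P → ℝ)

/-- The expected exponential of the supremum of a random walk with values in `ι → ℝ`, started at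
`S`, whose increments are `± u p - c p` for the nodes `p` of a tree along a random path. -/
noncomputable def treeVal : ℕ → (List Bool → P) → (ι → ℝ) → ℝ≥0∞
  | 0, _, S => ⨆ i, ENNReal.ofReal (Real.exp (S i))
  | r + 1, x, S => 2⁻¹ * ∑ b : Bool, treeVal r (fun l => x (b :: l))
      (fun i => S i + (sgn b * u (x []) i - c (x [])))

/-- The supremum of `treeVal` over all trees. -/
noncomputable def gameVal (r : ℕ) (S : ι → ℝ) : ℝ≥0∞ := ⨆ x, treeVal u c r x S

/-- Semicontinuity is the route to measurability of `gameVal`: it survives the supremum over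
uncountably many trees, which measurability alone would not. -/
theorem lowerSemicontinuous_treeVal (r : ℕ) (x : List Bool → P) :
    LowerSemicontinuous (treeVal u c r x) := by
  induction r generalizing x with
  | zero =>
    change LowerSemicontinuous fun S : ι → ℝ => ⨆ i, ENNReal.ofReal (Real.exp (S i))
    exact lowerSemicontinuous_iSup fun i =>
      (ENNReal.continuous_ofReal.comp (by fun_prop)).lowerSemicontinuous
  | succ r ih =>
    change LowerSemicontinuous fun S : ι → ℝ => 2⁻¹ * ∑ b : Bool, treeVal u c r
      (fun l => x (b :: l)) (fun i => S i + (sgn b * u (x []) i - c (x [])))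
    refine Continuous.comp_lowerSemicontinuous (g := fun y : ℝ≥0∞ => 2⁻¹ * y)
      (ENNReal.continuous_const_mul (by simp)) ?_ (fun a b h => by dsimp; gcongr)
    simp only [Fintype.sum_bool]
    exact LowerSemicontinuous.add ((ih _).comp (by fun_prop)) ((ih _).comp (by fun_prop))

theorem lowerSemicontinuous_gameVal (r : ℕ) : LowerSemicontinuous (gameVal u c r) :=
  lowerSemicontinuous_iSup fun x => lowerSemicontinuous_treeVal u c r x

theorem measurable_treeVal [Countable ι] (r : ℕ) (x : List Bool → P) :
    Measurable (treeVal u c r x) :=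
  (lowerSemicontinuous_treeVal u c r x).measurable

theorem measurable_gameVal [Countable ι] (r : ℕ) : Measurable (gameVal u c r) :=
  (lowerSemicontinuous_gameVal u c r).measurable

theorem ofReal_exp_integral_le {Z : Type*} [MeasurableSpace Z] (ν : Measure Z)
    [IsProbabilityMeasure ν] (g : Z → ℝ) (hg : Measurable g) (K : ℝ) (hK : ∀ y, |g y| ≤ K) :
    ENNReal.ofReal (Real.exp (∫ y, g y ∂ν)) ≤ ∫⁻ y, ENNReal.ofReal (Real.exp (g y)) ∂ν := by
  have hi : Integrable g ν :=
    Integrable.of_bound hg.aestronglyMeasurable K (ae_of_all _ hK)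
  have hi' : Integrable (fun y => Real.exp (g y)) ν :=
    Integrable.of_bound (by fun_prop) (Real.exp K) (ae_of_all _ fun y => by
      simpa using (abs_le.1 (hK y)).2)
  rw [← ofReal_integral_eq_lintegral_ofReal hi' (ae_of_all _ fun y => (Real.exp_pos _).le)]
  exact ENNReal.ofReal_le_ofReal (convexOn_exp.map_integral_le Real.continuous_exp.continuousOn
    isClosed_univ (ae_of_all _ fun _ => Set.mem_univ _) hi hi')

/-- Jensen's inequality: `treeVal` arises from `exp` by suprema, averages and translations, all of
which preserve convexity in the starting point. -/
theorem treeVal_integral_le [Countable ι] {Z : Type*} [MeasurableSpace Z] (ν : Measure Z)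
    [IsProbabilityMeasure ν] (r : ℕ) (x : List Bool → P) (g : ι → Z → ℝ)
    (hg : ∀ i, Measurable (g i)) (hK : ∀ i, ∃ K, ∀ y, |g i y| ≤ K) :
    treeVal u c r x (fun i => ∫ y, g i y ∂ν) ≤ ∫⁻ y, treeVal u c r x (fun i => g i y) ∂ν := by
  induction r generalizing x g with
  | zero =>
    simp only [treeVal]
    refine iSup_le fun i => ?_
    obtain ⟨K, hK⟩ := hK i
    exact (ofReal_exp_integral_le ν (g i) (hg i) K hK).trans
      (lintegral_mono fun y => le_iSup (fun i => ENNReal.ofReal (Real.exp (g i y))) i)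
  | succ r ih =>
    simp only [treeVal]
    rw [lintegral_const_mul, lintegral_finsetSum]
    · gcongr with b
      refine le_trans (le_of_eq ?_) (ih (fun l => x (b :: l))
        (fun i y => g i y + (sgn b * u (x []) i - c (x []))) (fun i => (hg i).add_const _) ?_)
      · congr 1
        funext i
        obtain ⟨K, hK⟩ := hK i
        rw [integral_add (Integrable.of_bound (hg i).aestronglyMeasurable K (ae_of_all _ hK))
          (integrable_const _)]
        simp
      · intro i
        obtain ⟨K, hK⟩ := hK i
        exact ⟨K + |sgn b * u (x []) i - c (x [])|, fun y =>
          (abs_add_le _ _).trans (by gcongr; exact hK y)⟩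
    · intro b _
      exact (measurable_treeVal u c r _).comp
        (measurable_pi_lambda _ fun i => (hg i).add_const _)
    · refine Finset.measurable_fun_sum _ fun b _ => ?_
      exact (measurable_treeVal u c r _).comp
        (measurable_pi_lambda _ fun i => (hg i).add_const _)

theorem gameVal_integral_le [Countable ι] {Z : Type*} [MeasurableSpace Z] (ν : Measure Z)
    [IsProbabilityMeasure ν] (r : ℕ) (g : ι → Z → ℝ)
    (hg : ∀ i, Measurable (g i)) (hK : ∀ i, ∃ K, ∀ y, |g i y| ≤ K) :
    gameVal u c r (fun i => ∫ y, g i y ∂ν) ≤ ∫⁻ y, gameVal u c r (fun i => g i y) ∂ν :=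
  iSup_le fun x => (treeVal_integral_le u c ν r x g hg hK).trans
    (lintegral_mono fun y => le_iSup (fun x => treeVal u c r x (fun i => g i y)) x)

/-- Two trees chosen independently for the two signs can be glued below the root `p`. -/
theorem gameVal_step_le (r : ℕ) (p : P) (S : ι → ℝ) :
    2⁻¹ * (gameVal u c r (fun i => S i + (u p i - c p))
      + gameVal u c r (fun i => S i + (-u p i - c p))) ≤ gameVal u c (r + 1) S := by
  have : Nonempty P := ⟨p⟩
  rw [ENNReal.inv_mul_le_iff (by simp) (by simp)]
  refine ENNReal.iSup_add_iSup_le fun x y => ?_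
  rw [← ENNReal.inv_mul_le_iff (by simp) (by simp)]
  let z : List Bool → P
    | [] => p
    | b :: l => if b then x l else y l
  refine le_trans (le_of_eq ?_) (le_iSup (fun z => treeVal u c (r + 1) z S) z)
  simp [treeVal, z]

/-- A null node leaves the walk in place; this handles the rounds without an update. -/
theorem gameVal_le_succ (r : ℕ) (p : P) (hu : u p = 0) (hc : c p = 0) (S : ι → ℝ) :
    gameVal u c r S ≤ gameVal u c (r + 1) S := by
  refine le_trans (le_of_eq ?_) (gameVal_step_le u c r p S)
  simp only [hu, hc, Pi.zero_apply, neg_zero, sub_zero, add_zero]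
  rw [← two_mul, ← mul_assoc, ENNReal.inv_mul_cancel (by simp) (by simp), one_mul]

/-- The node of `x` at level `t` along the path `e`. -/
def nodeAt {n : ℕ} (x : List Bool → P) (e : Fin n → Bool) (t : Fin n) : P :=
  x (List.ofFn fun i : Fin t => e (Fin.castLE t.isLt.le i))

theorem nodeAt_congr {n : ℕ} (x : List Bool → P) {e e' : Fin n → Bool} {t : Fin n}
    (h : ∀ i < t, e i = e' i) : nodeAt x e t = nodeAt x e' t := by
  unfold nodeAt
  congr 2
  funext i
  exact h _ (by simp [Fin.lt_def])

theorem treeVal_eq_sum (n : ℕ) (x : List Bool → P) (S : ι → ℝ) :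
    treeVal u c n x S = 2⁻¹ ^ n * ∑ e : Fin n → Bool, ⨆ i, ENNReal.ofReal (Real.exp
      (S i + ∑ t, (sgn (e t) * u (nodeAt x e t) i - c (nodeAt x e t)))) := by
  induction n generalizing x S with
  | zero => simp [treeVal]
  | succ n ih =>
    rw [treeVal, ← (Fin.consEquiv (fun _ : Fin (n + 1) => Bool)).sum_comp,
      Fintype.sum_prod_type, pow_succ', mul_assoc]
    congr 1
    rw [Finset.mul_sum]
    refine Finset.sum_congr rfl fun b _ => ?_
    rw [ih]
    congr 1
    refine Finset.sum_congr rfl fun e _ => ?_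
    congr 1
    funext i
    rw [Fin.sum_univ_succ, ← add_assoc]
    congr 3
    refine Finset.sum_congr rfl fun t _ => ?_
    have : nodeAt (fun l => x (b :: l)) e t
        = nodeAt x ((Fin.consEquiv (fun _ : Fin (n + 1) => Bool)) (b, e)) t.succ := by
      simp only [nodeAt]
      congr 1
      symm
      exact List.ofFn_succ
    rw [this]
    rfl

end Game

/-! ### Covers bound the value of the game -/

/-- Along each path, a cover element replaces `f i` at a cost of `2 * |l| * β` per round. Centring
at `1 / 2` bounds the new coefficient by `|l|`, so `l ^ 2 / 2` compensates it. The predictable mask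
`w` marks the rounds that are not skipped. -/
theorem sum_iSup_exp_le_card {Z ι : Type*} {n : ℕ} (f : ι → Z → ℝ)
    (hf : ∀ i y, f i y ∈ Set.Icc (0 : ℝ) 1) (β l : ℝ) (x : SeqTree Z n)
    (w : Fin n → (Fin n → Bool) → Bool)
    (hw : ∀ t e e', (∀ i < t, e i = e' i) → w t e = w t e')
    (C : Finset (SeqTree ℝ n)) (hC : IsSeqCover (Set.range f) β x C) :
    ∑ e : Fin n → Bool, ⨆ i, ENNReal.ofReal (Real.exp (∑ t, if w t e then
      2 * l * sgn (e t) * (f i (x.along e t) - 1 / 2) - (l ^ 2 / 2 + 2 * |l| * β) else 0))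
      ≤ 2 ^ n * C.card := by
  -- Cover elements may leave `[0, 1]`; clipping does not worsen the approximation of values in `[0,
  -- 1]`.
  set cl : ℝ → ℝ := fun v => max 0 (min 1 v)
  have hcl : ∀ p v : ℝ, p ∈ Set.Icc (0 : ℝ) 1 → |p - v| ≤ β → |p - cl v| ≤ β := by
    intro p v hp h
    have h1 := abs_le.1 h
    simp only [cl]
    rw [abs_le]
    rcases le_total 1 v with h2 | h2
    · rw [min_eq_left h2, max_eq_right zero_le_one]
      constructor <;> linarith [hp.1, hp.2, h1.1, h1.2]
    · rw [min_eq_right h2]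
      rcases le_total 0 v with h3 | h3
      · rw [max_eq_right h3]; exact h1
      · rw [max_eq_left h3]
        constructor <;> linarith [hp.1, hp.2, h1.1, h1.2]
  have hcl01 : ∀ v, (cl v - 1 / 2) ^ 2 ≤ 1 / 4 := by
    intro v
    have h1 : 0 ≤ cl v := le_max_left _ _
    have h2 : cl v ≤ 1 := max_le zero_le_one (min_le_left _ _)
    nlinarith
  set a : SeqTree ℝ n → Fin n → (Fin n → Bool) → ℝ := fun v t e =>
    if w t e then 2 * l * (cl (v.along e t) - 1 / 2) else 0
  have hstep : ∀ e : Fin n → Bool, (⨆ i, ENNReal.ofReal (Real.exp (∑ t, if w t e then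
      2 * l * sgn (e t) * (f i (x.along e t) - 1 / 2) - (l ^ 2 / 2 + 2 * |l| * β) else 0)))
      ≤ ∑ v ∈ C, ENNReal.ofReal (Real.exp (∑ t, (sgn (e t) * a v t e - a v t e ^ 2 / 2))) := by
    intro e
    refine iSup_le fun i => ?_
    obtain ⟨v, hv, hve⟩ := hC (f i) ⟨i, rfl⟩ e
    refine le_trans ?_ (Finset.single_le_sum (f := fun v => ENNReal.ofReal
      (Real.exp (∑ t, (sgn (e t) * a v t e - a v t e ^ 2 / 2)))) (fun _ _ => zero_le)
      (Finset.mem_coe.1 hv))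
    refine ENNReal.ofReal_le_ofReal (Real.exp_le_exp.2 (Finset.sum_le_sum fun t _ => ?_))
    simp only [a]
    split_ifs with h
    · have h1 := hcl _ _ (hf i (x.along e t)) (hve t)
      have h2 := hcl01 (v.along e t)
      have h3 : l * sgn (e t) * (f i (x.along e t) - cl (v.along e t)) ≤ |l| * β := by
        calc _ ≤ |l * sgn (e t) * (f i (x.along e t) - cl (v.along e t))| := le_abs_self _
          _ = |l| * |f i (x.along e t) - cl (v.along e t)| := by
            rw [abs_mul, abs_mul]
            cases e t <;> simp
          _ ≤ _ := by gcongr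
      nlinarith [mul_le_mul_of_nonneg_left h2 (sq_nonneg l)]
    · simp
  calc _ ≤ ∑ e : Fin n → Bool, ∑ v ∈ C,
        ENNReal.ofReal (Real.exp (∑ t, (sgn (e t) * a v t e - a v t e ^ 2 / 2))) :=
        Finset.sum_le_sum fun e _ => hstep e
    _ = ∑ v ∈ C, ∑ e : Fin n → Bool,
        ENNReal.ofReal (Real.exp (∑ t, (sgn (e t) * a v t e - a v t e ^ 2 / 2))) :=
        Finset.sum_comm
    _ ≤ ∑ v ∈ C, 2 ^ n := by
        refine Finset.sum_le_sum fun v _ => ?_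
        rw [← ENNReal.ofReal_sum_of_nonneg fun _ _ => (Real.exp_pos _).le]
        refine (ENNReal.ofReal_le_ofReal (sum_exp_predictable_le n (a v) ?_)).trans ?_
        · intro t e e' h
          have : v.along e t = v.along e' t := by
            unfold SeqTree.along
            congr 1
            funext i
            exact h _ (by simp [Fin.lt_def])
          simp only [a, hw t e e' h, this]
        · rw [ENNReal.ofReal_pow (by norm_num)]; simp
    _ = 2 ^ n * C.card := by simp [mul_comm]

theorem exists_finset_cover_of_seqCoveringNumber {Z : Type*} {F : Set (Z → ℝ)} {θ : ℝ} {n N : ℕ}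
    (h : seqCoveringNumber F θ n = N) (x : SeqTree Z n) :
    ∃ C : Finset (SeqTree ℝ n), IsSeqCover F θ x C ∧ C.card ≤ N := by
  have h1 : seqCoveringNumberOn F θ x < (N + 1 : ℕ) := by
    refine lt_of_le_of_lt ((le_iSup (seqCoveringNumberOn F θ) x).trans h.le) ?_
    exact_mod_cast Nat.lt_succ_self N
  unfold seqCoveringNumberOn at h1
  simp only [iInf_lt_iff] at h1
  obtain ⟨C, hC, hlt⟩ := h1
  have hfin : C.Finite := Set.encard_lt_top_iff.1 (hlt.trans (ENat.natCast_lt_top _))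
  refine ⟨hfin.toFinset, by simpa using hC, ?_⟩
  rw [hfin.encard_eq_coe_toFinset_card] at hlt
  exact Nat.lt_succ_iff.1 (by exact_mod_cast hlt)

/-! ### The symmetrized deviation process -/

section Symmetrized

variable {Z ι : Type*}

/-- The increments of the symmetrized deviation process: a node is a pair of points, or `none`
for a round that is skipped. -/
def symIncr (f : ι → Z → ℝ) (l : ℝ) : Option (Z × Z) → ι → ℝ
  | none, _ => 0
  | some p, i => l * (f i p.1 - f i p.2)

/-- The compensator of the symmetrized deviation process. -/
def symComp (q : ℝ) : Option (Z × Z) → ℝ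
  | none => 0
  | some _ => q

/-- The increment at a pair is the mean of two one-point increments, with parameters `l` and `-l`;
the centrings by `1 / 2` cancel. Convexity of `exp` therefore splits the pair tree into two
`Z`-valued trees, each covered separately, and averaging the two bounds gives `N` back. -/
theorem treeVal_sym_le [Nonempty Z] (f : ι → Z → ℝ) (hf : ∀ i y, f i y ∈ Set.Icc (0 : ℝ) 1)
    {β l : ℝ} {n N : ℕ}
    (hN : ∀ x : SeqTree Z n, ∃ C : Finset (SeqTree ℝ n),
      IsSeqCover (Set.range f) β x C ∧ C.card ≤ N)
    (x : List Bool → Option (Z × Z)) :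
    treeVal (symIncr f l) (symComp (l ^ 2 / 2 + 2 * |l| * β)) n x 0 ≤ N := by
  set q := l ^ 2 / 2 + 2 * |l| * β with hq
  -- Filler for skipped nodes, whose contribution is masked by `w`.
  let y₀ : Z := Classical.arbitrary Z
  let x₁ : SeqTree Z n := fun t p => ((x (List.ofFn p)).map Prod.fst).getD y₀
  let x₂ : SeqTree Z n := fun t p => ((x (List.ofFn p)).map Prod.snd).getD y₀
  let w : Fin n → (Fin n → Bool) → Bool := fun t e => (nodeAt x e t).isSome
  have hw : ∀ t e e', (∀ i < t, e i = e' i) → w t e = w t e' := fun t e e' h => by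
    simp only [w, nodeAt_congr x h]
  obtain ⟨C₁, hC₁, hN₁⟩ := hN x₁
  obtain ⟨C₂, hC₂, hN₂⟩ := hN x₂
  have b₁ := sum_iSup_exp_le_card f hf β l x₁ w hw C₁ hC₁
  have b₂ := sum_iSup_exp_le_card f hf β (-l) x₂ w hw C₂ hC₂
  rw [neg_sq, abs_neg, ← hq] at b₂
  rw [← hq] at b₁
  set T₁ : (Fin n → Bool) → ι → ℝ := fun e i => ∑ t, if w t e then
      2 * l * sgn (e t) * (f i (x₁.along e t) - 1 / 2) - q else 0 with hT₁
  set T₂ : (Fin n → Bool) → ι → ℝ := fun e i => ∑ t, if w t e then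
      2 * (-l) * sgn (e t) * (f i (x₂.along e t) - 1 / 2) - q else 0 with hT₂
  have key : ∀ e i, ∑ t, (sgn (e t) * symIncr f l (nodeAt x e t) i - symComp q (nodeAt x e t))
      = (T₁ e i + T₂ e i) / 2 := by
    intro e i
    simp only [hT₁, hT₂]
    rw [← Finset.sum_add_distrib, Finset.sum_div]
    refine Finset.sum_congr rfl fun t _ => ?_
    change _ = ((if (nodeAt x e t).isSome then
      2 * l * sgn (e t) * (f i (((nodeAt x e t).map Prod.fst).getD y₀) - 1 / 2) - q else 0)
      + (if (nodeAt x e t).isSome then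
      2 * (-l) * sgn (e t) * (f i (((nodeAt x e t).map Prod.snd).getD y₀) - 1 / 2) - q else 0)) / 2
    generalize nodeAt x e t = p
    cases p with
    | none => simp [symIncr, symComp]
    | some p => simp [symIncr, symComp]; ring
  have hexp : ∀ s t : ℝ, ENNReal.ofReal (Real.exp ((s + t) / 2))
      ≤ 2⁻¹ * (ENNReal.ofReal (Real.exp s) + ENNReal.ofReal (Real.exp t)) := by
    intro s t
    rw [← ENNReal.ofReal_add (Real.exp_pos _).le (Real.exp_pos _).le,
      show (2⁻¹ : ℝ≥0∞) = ENNReal.ofReal (2⁻¹) by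
        rw [ENNReal.ofReal_inv_of_pos (by norm_num)]; simp,
      ← ENNReal.ofReal_mul (by norm_num)]
    refine ENNReal.ofReal_le_ofReal ?_
    have h₁ : Real.exp s = Real.exp (s / 2) ^ 2 := by rw [← Real.exp_nat_mul]; ring_nf
    have h₂ : Real.exp t = Real.exp (t / 2) ^ 2 := by rw [← Real.exp_nat_mul]; ring_nf
    rw [add_div, Real.exp_add, h₁, h₂]
    nlinarith [sq_nonneg (Real.exp (s / 2) - Real.exp (t / 2))]
  rw [treeVal_eq_sum]
  simp only [Pi.zero_apply, zero_add, key]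
  calc (2⁻¹ : ℝ≥0∞) ^ n * ∑ e : Fin n → Bool, ⨆ i, ENNReal.ofReal (Real.exp ((T₁ e i + T₂ e i) / 2))
      ≤ 2⁻¹ ^ n * ∑ e : Fin n → Bool, 2⁻¹ * ((⨆ i, ENNReal.ofReal (Real.exp (T₁ e i)))
          + ⨆ i, ENNReal.ofReal (Real.exp (T₂ e i))) := by
        gcongr with e
        refine iSup_le fun i => (hexp _ _).trans ?_
        gcongr
        · exact le_iSup (fun i => ENNReal.ofReal (Real.exp (T₁ e i))) i
        · exact le_iSup (fun i => ENNReal.ofReal (Real.exp (T₂ e i))) i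
    _ ≤ 2⁻¹ ^ n * (2⁻¹ * (2 ^ n * C₁.card + 2 ^ n * C₂.card)) := by
        rw [← Finset.mul_sum, Finset.sum_add_distrib]
        gcongr
    _ ≤ 2⁻¹ ^ n * (2⁻¹ * (2 ^ n * N + 2 ^ n * N)) := by gcongr
    _ = N := by
        rw [← two_mul, ← mul_assoc 2⁻¹ 2, ENNReal.inv_mul_cancel (by simp) (by simp), one_mul,
          ← mul_assoc, ← mul_pow, ENNReal.inv_mul_cancel (by simp) (by simp), one_pow, one_mul]

theorem gameVal_sym_le [Nonempty Z] (f : ι → Z → ℝ) (hf : ∀ i y, f i y ∈ Set.Icc (0 : ℝ) 1)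
    {β l : ℝ} {n N : ℕ}
    (hN : ∀ x : SeqTree Z n, ∃ C : Finset (SeqTree ℝ n),
      IsSeqCover (Set.range f) β x C ∧ C.card ≤ N) :
    gameVal (symIncr f l) (symComp (l ^ 2 / 2 + 2 * |l| * β)) n 0 ≤ N :=
  iSup_le fun x => treeVal_sym_le f hf hN x

end Symmetrized

/-! ### Exponential supermartingales of the observed process -/

section Supermartingale

variable {Ω Z : Type*} [MeasurableSpace Ω] [MeasurableSpace Z]

theorem measurable_hist {z : ℕ → Ω → Z} (hz : ∀ t, Measurable (z t)) (t : ℕ) :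
    Measurable (hist z t) :=
  measurable_pi_lambda _ fun i => hz i

theorem snoc_hist {Ω Z : Type*} (z : ℕ → Ω → Z) (t : ℕ) (ω : Ω) :
    Fin.snoc (α := fun _ => Z) (hist z t ω) (z t ω) = hist z (t + 1) ω := by
  funext i
  refine Fin.lastCases ?_ (fun i => ?_) i
  · simp [hist]
  · simp [hist]

theorem measurable_snoc (t : ℕ) :
    Measurable fun p : (Fin t → Z) × Z => Fin.snoc (α := fun _ => Z) p.1 p.2 := by
  refine measurable_pi_lambda _ fun i => ?_
  refine Fin.lastCases ?_ (fun i => ?_) i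
  · simpa using measurable_snd
  · simp only [Fin.snoc_castSucc]
    exact (measurable_pi_apply i).comp measurable_fst

theorem lintegral_hist_succ (μ : Measure Ω) [IsProbabilityMeasure μ] {z : ℕ → Ω → Z}
    (hz : ∀ t, Measurable (z t)) {t : ℕ} {κ : Kernel (Fin t → Z) Z} [IsMarkovKernel κ]
    (hκ : HasCondDistrib (z t) (hist z t) κ μ) {Y : (Fin (t + 1) → Z) → ℝ≥0∞}
    (hY : Measurable Y) :
    ∫⁻ ω, Y (hist z (t + 1) ω) ∂μ
      = ∫⁻ ω, ∫⁻ y, Y (Fin.snoc (α := fun _ => Z) (hist z t ω) y) ∂κ (hist z t ω) ∂μ := by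
  have hYs : Measurable fun p : (Fin t → Z) × Z => Y (Fin.snoc (α := fun _ => Z) p.1 p.2) :=
    hY.comp (measurable_snoc t)
  have hh := measurable_hist hz t
  calc _ = ∫⁻ ω, Y (Fin.snoc (α := fun _ => Z) (hist z t ω) (z t ω)) ∂μ := by
        simp only [snoc_hist]
    _ = ∫⁻ p, Y (Fin.snoc (α := fun _ => Z) p.1 p.2) ∂(μ.map fun ω => (hist z t ω, z t ω)) :=
        (lintegral_map hYs (hh.prodMk (hz t))).symm
    _ = ∫⁻ p, Y (Fin.snoc (α := fun _ => Z) p.1 p.2) ∂(μ.map (hist z t) ⊗ₘ κ) := by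
        rw [hκ.map_eq]
    _ = ∫⁻ x, ∫⁻ y, Y (Fin.snoc (α := fun _ => Z) x y) ∂κ x ∂(μ.map (hist z t)) :=
        Measure.lintegral_compProd hYs
    _ = _ := lintegral_map hYs.lintegral_kernel_prod_right' hh

/-- The tower property, iterated: a function of the history that does not increase in conditional
mean is bounded in mean by its deterministic initial value. -/
theorem lintegral_hist_le (μ : Measure Ω) [IsProbabilityMeasure μ] {z : ℕ → Ω → Z}
    (hz : ∀ t, Measurable (z t)) {κ : (t : ℕ) → Kernel (Fin t → Z) Z} [∀ t, IsMarkovKernel (κ t)]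
    (hκ : ∀ t, HasCondDistrib (z t) (hist z t) (κ t) μ) (n : ℕ)
    {Y : (t : ℕ) → (Fin t → Z) → ℝ≥0∞} (hY : ∀ t, Measurable (Y t))
    (hstep : ∀ t < n, ∀ x, ∫⁻ y, Y (t + 1) (Fin.snoc (α := fun _ => Z) x y) ∂κ t x ≤ Y t x) :
    ∫⁻ ω, Y n (hist z n ω) ∂μ ≤ Y 0 (fun i => i.elim0) := by
  induction n with
  | zero =>
    have : ∀ ω, hist z 0 ω = fun i => i.elim0 := fun ω => funext fun i => i.elim0
    simp [this]
  | succ n ih =>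
    rw [lintegral_hist_succ μ hz (hκ n) (hY _)]
    exact (lintegral_mono fun ω => hstep n n.lt_succ_self _).trans
      (ih fun t ht => hstep t (ht.trans n.lt_succ_self))

/-- The sum of the terms `G t`, evaluated at the history before round `t` and the observation of
round `t`, over the rounds `t` in which the history lies in `B t`. -/
noncomputable def selSum (B : (t : ℕ) → Set (Fin t → Z)) (G : (t : ℕ) → (Fin t → Z) → Z → ℝ) :
    (t : ℕ) → (Fin t → Z) → ℝ
  | 0, _ => 0
  | t + 1, x => selSum B G t (Fin.init x)
      + (B t).indicator (fun x' => G t x' (x (Fin.last t))) (Fin.init x)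

theorem selSum_snoc {Z : Type*} (B : (t : ℕ) → Set (Fin t → Z))
    (G : (t : ℕ) → (Fin t → Z) → Z → ℝ) (t : ℕ) (x : Fin t → Z) (y : Z) : selSum B G (t + 1) (Fin.snoc (α := fun _ => Z) x y)
      = selSum B G t x + (B t).indicator (fun x' => G t x' y) x := by
  rw [selSum, Fin.init_snoc, Fin.snoc_last]

open Classical in
theorem selSum_hist {Ω Z : Type*} (B : (t : ℕ) → Set (Fin t → Z))
    (G : (t : ℕ) → (Fin t → Z) → Z → ℝ)
    (z : ℕ → Ω → Z) (n : ℕ) (ω : Ω) : selSum B G n (hist z n ω)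
      = ∑ t ∈ Finset.range n, if hist z t ω ∈ B t then G t (hist z t ω) (z t ω) else 0 := by
  induction n with
  | zero => simp [selSum]
  | succ n ih =>
    rw [← snoc_hist, selSum_snoc, ih, Finset.sum_range_succ, Set.indicator_apply]

theorem measurable_selSum {B : (t : ℕ) → Set (Fin t → Z)} (hB : ∀ t, MeasurableSet (B t))
    {G : (t : ℕ) → (Fin t → Z) → Z → ℝ} (hG : ∀ t, Measurable (Function.uncurry (G t))) (t : ℕ) :
    Measurable (selSum B G t) := by
  induction t with
  | zero => exact measurable_const
  | succ t ih =>
    have hinit : Measurable (Fin.init : (Fin (t + 1) → Z) → Fin t → Z) :=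
      measurable_pi_lambda _ fun i => measurable_pi_apply _
    refine (ih.comp hinit).add ?_
    have h1 : Measurable fun x : Fin (t + 1) → Z => G t (Fin.init x) (x (Fin.last t)) :=
      (hG t).comp (hinit.prodMk (measurable_pi_apply _))
    exact h1.indicator (hinit (hB t))

/-- Hoeffding's lemma: a variable in `[0, 1]` is sub-Gaussian with variance proxy `1 / 4`. -/
theorem lintegral_exp_hoeffding_le_one (ν : Measure Z) [IsProbabilityMeasure ν] {g : Z → ℝ}
    (hg : Measurable g) (hg01 : ∀ y, g y ∈ Set.Icc (0 : ℝ) 1) (l : ℝ) :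
    ∫⁻ y, ENNReal.ofReal (Real.exp (l * (∫ y', g y' ∂ν - g y) - l ^ 2 / 8)) ∂ν ≤ 1 := by
  have h := hasSubgaussianMGF_of_mem_Icc (μ := ν) hg.aemeasurable (ae_of_all _ hg01)
  have h1 := h.mgf_le (-l)
  have h2 := h.integrable_exp_mul (-l)
  have h3 : ∀ y, Real.exp (l * (∫ y', g y' ∂ν - g y) - l ^ 2 / 8)
      = Real.exp (-l * (g y - ∫ y', g y' ∂ν)) * Real.exp (-(l ^ 2 / 8)) := fun y => by
    rw [← Real.exp_add]; ring_nf
  simp only [h3]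
  rw [← ofReal_integral_eq_lintegral_ofReal (h2.mul_const _) (ae_of_all _ fun y => by positivity),
    integral_mul_const]
  refine ENNReal.ofReal_le_one.2 ?_
  calc _ ≤ Real.exp (l ^ 2 / 8) * Real.exp (-(l ^ 2 / 8)) := by
        gcongr
        refine h1.trans (le_of_eq ?_)
        congr 1
        simp
        ring
    _ = 1 := by rw [← Real.exp_add]; simp

variable (μ : Measure Ω) [IsProbabilityMeasure μ] {z : ℕ → Ω → Z}
    {κ : (t : ℕ) → Kernel (Fin t → Z) Z} [∀ t, IsMarkovKernel (κ t)]

/-- An Azuma–Hoeffding bound for a predictable selection of rounds. -/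
theorem measure_selSum_hoeffding_le (hz : ∀ t, Measurable (z t))
    (hκ : ∀ t, HasCondDistrib (z t) (hist z t) (κ t) μ)
    {B : (t : ℕ) → Set (Fin t → Z)} (hB : ∀ t, MeasurableSet (B t))
    {g : (t : ℕ) → (Fin t → Z) → Z → ℝ} (hg : ∀ t, Measurable (Function.uncurry (g t)))
    (hg01 : ∀ t x y, g t x y ∈ Set.Icc (0 : ℝ) 1) (l C : ℝ) (n : ℕ) :
    μ {ω | C ≤ selSum B (fun t x y => l * (∫ y', g t x y' ∂κ t x - g t x y) - l ^ 2 / 8) n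
      (hist z n ω)} ≤ ENNReal.ofReal (Real.exp (-C)) := by
  set G : (t : ℕ) → (Fin t → Z) → Z → ℝ :=
    fun t x y => l * (∫ y', g t x y' ∂κ t x - g t x y) - l ^ 2 / 8 with hG
  have hGm : ∀ t, Measurable (Function.uncurry (G t)) := fun t => by
    have h1 : Measurable fun x => ∫ y', g t x y' ∂κ t x :=
      ((hg t).stronglyMeasurable.integral_kernel_prod_right').measurable
    exact (((h1.comp measurable_fst).sub (hg t)).const_mul l).sub_const _
  have hS := measurable_selSum hB hGm
  have hY : ∀ t, Measurable fun x => ENNReal.ofReal (Real.exp (selSum B G t x)) := fun t =>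
    (Real.measurable_exp.comp (hS t)).ennreal_ofReal
  have h := lintegral_hist_le μ hz hκ n hY (fun t _ x => by
    simp only [selSum_snoc, Real.exp_add, ENNReal.ofReal_mul (Real.exp_pos _).le]
    by_cases hx : x ∈ B t
    · simp only [Set.indicator_of_mem hx]
      have hgm : Measurable (g t x) := (hg t).comp measurable_prodMk_left
      rw [lintegral_const_mul _ (by
        exact (Real.measurable_exp.comp ((hGm t).comp measurable_prodMk_left)).ennreal_ofReal)]
      exact mul_le_of_le_one_right' (lintegral_exp_hoeffding_le_one (κ t x) hgm (hg01 t x) l)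
    · simp [Set.indicator_of_notMem hx])
  have h0 : ENNReal.ofReal (Real.exp C) ≠ 0 := by simp [Real.exp_pos]
  have hmk := mul_meas_ge_le_lintegral₀ (μ := μ)
    ((hY n).comp (measurable_hist hz n)).aemeasurable (ENNReal.ofReal (Real.exp C))
  have hle : ENNReal.ofReal (Real.exp C) * μ {ω | C ≤ selSum B G n (hist z n ω)} ≤ 1 := by
    refine le_trans ?_ (hmk.trans (h.trans (by simp [selSum])))
    gcongr
    exact fun hω => ENNReal.ofReal_le_ofReal (Real.exp_le_exp.2 hω)
  rw [Real.exp_neg, ENNReal.ofReal_inv_of_pos (Real.exp_pos _)]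
  rwa [mul_comm, ← ENNReal.le_div_iff_mul_le (Or.inl h0) (Or.inl ENNReal.ofReal_ne_top),
    one_div] at hle

/-- The mean of `f i` is an integral over a ghost point `y'`, which Jensen moves outside. Since `y`
and `y'` are exchangeable, the double integral equals its average over the two orders, which is a
fair sign in front of `l * (f i y - f i y')`. For each fixed pair this is one move of the game with
node `(y, y')`. -/
theorem lintegral_gameVal_sym_le {ι : Type*} [Countable ι] (ν : Measure Z) [IsProbabilityMeasure ν]
    (f : ι → Z → ℝ) (hfm : ∀ i, Measurable (f i)) (hf : ∀ i y, f i y ∈ Set.Icc (0 : ℝ) 1)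
    (l q : ℝ) (r : ℕ) (S : ι → ℝ) :
    ∫⁻ y, gameVal (symIncr f l) (symComp q) r
      (fun i => S i + (l * (f i y - ∫ y', f i y' ∂ν) - q)) ∂ν
      ≤ gameVal (symIncr f l) (symComp q) (r + 1) S := by
  have hVm : ∀ r, Measurable (gameVal (symIncr f l) (symComp (Z := Z) q) r) :=
    measurable_gameVal _ _
  have hJ := gameVal_integral_le (symIncr f l) (symComp (Z := Z) q) ν r
  have hstep : ∀ y y', 2⁻¹ * (gameVal (symIncr f l) (symComp q) r
        (fun i => S i + (l * (f i y - f i y') - q))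
      + gameVal (symIncr f l) (symComp q) r (fun i => S i + (-(l * (f i y - f i y')) - q)))
      ≤ gameVal (symIncr f l) (symComp q) (r + 1) S := fun y y' =>
    gameVal_step_le (symIncr f l) (symComp q) r (some (y, y')) S
  generalize gameVal (symIncr f l) (symComp (Z := Z) q) = V at *
  set D : Z → Z → ℝ≥0∞ := fun y y' => V r (fun i => S i + (l * (f i y - f i y') - q)) with hD
  have hDm : Measurable (Function.uncurry D) := by
    refine (hVm r).comp (measurable_pi_lambda _ fun i => ?_)
    have := hfm i
    fun_prop
  have hfi : ∀ i, Integrable (f i) ν := fun i =>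
    Integrable.of_mem_Icc 0 1 (hfm i).aemeasurable (ae_of_all _ (hf i))
  have h1 : ∀ y, V r (fun i => S i + (l * (f i y - ∫ y', f i y' ∂ν) - q))
      ≤ ∫⁻ y', D y y' ∂ν := by
    intro y
    refine le_trans (le_of_eq ?_) (hJ
      (fun i y' => S i + (l * (f i y - f i y') - q)) (fun i => ?_) (fun i => ?_))
    · congr 1
      funext i
      have e1 : ∀ y', S i + (l * (f i y - f i y') - q) = (S i + l * f i y - q) - l * f i y' :=
        fun y' => by ring
      simp only [e1]
      rw [integral_sub (integrable_const _) ((hfi i).const_mul l), integral_const_mul]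
      simp
      ring
    · have := hfm i
      fun_prop
    · refine ⟨|S i| + (|l| * 1 + |q|), fun y' => (abs_add_le _ _).trans ?_⟩
      gcongr
      refine (abs_sub _ _).trans ?_
      gcongr
      rw [abs_mul]
      gcongr
      have a1 := hf i y
      have a2 := hf i y'
      rw [abs_le]
      constructor <;> linarith [a1.1, a1.2, a2.1, a2.2]
  have h2 : ∫⁻ y, ∫⁻ y', D y y' ∂ν ∂ν = ∫⁻ y, ∫⁻ y', D y' y ∂ν ∂ν :=
    lintegral_lintegral_swap hDm.aemeasurable
  have hDm1 : ∀ y, Measurable fun y' => D y y' := fun y => hDm.comp measurable_prodMk_left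
  calc _ ≤ ∫⁻ y, ∫⁻ y', D y y' ∂ν ∂ν := lintegral_mono h1
    _ = 2⁻¹ * (∫⁻ y, ∫⁻ y', D y y' ∂ν ∂ν + ∫⁻ y, ∫⁻ y', D y' y ∂ν ∂ν) := by
        rw [← h2, ← two_mul, ← mul_assoc, ENNReal.inv_mul_cancel (by simp) (by simp), one_mul]
    _ = ∫⁻ y, ∫⁻ y', 2⁻¹ * (D y y' + D y' y) ∂ν ∂ν := by
        have hDm2 : Measurable fun y => ∫⁻ y', D y y' ∂ν := hDm.lintegral_prod_right'
        rw [← lintegral_add_left hDm2, ← lintegral_const_mul']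
        · refine lintegral_congr fun y => ?_
          rw [← lintegral_add_left (hDm1 y), ← lintegral_const_mul' _ _ (by simp)]
        · simp
    _ ≤ ∫⁻ y, ∫⁻ y', V (r + 1) S ∂ν ∂ν := by
        refine lintegral_mono fun y => lintegral_mono fun y' => ?_
        refine le_trans (le_of_eq ?_) (hstep y y')
        simp only [hD]
        congr 3
        funext i
        ring
    _ = V (r + 1) S := by simp

/-- The sequential uniform deviation bound for a predictable selection of rounds. -/
theorem measure_exists_selSum_le {ι : Type*} [Countable ι] (hz : ∀ t, Measurable (z t))
    (hκ : ∀ t, HasCondDistrib (z t) (hist z t) (κ t) μ)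
    {B : (t : ℕ) → Set (Fin t → Z)} (hB : ∀ t, MeasurableSet (B t))
    (f : ι → Z → ℝ) (hfm : ∀ i, Measurable (f i)) (hf : ∀ i y, f i y ∈ Set.Icc (0 : ℝ) 1)
    {β l : ℝ} {n N : ℕ}
    (hN : ∀ x : SeqTree Z n, ∃ C : Finset (SeqTree ℝ n),
      IsSeqCover (Set.range f) β x C ∧ C.card ≤ N) (C : ℝ) :
    μ {ω | ∃ i, C ≤ selSum B (fun t x y => l * (f i y - ∫ y', f i y' ∂κ t x)
        - (l ^ 2 / 2 + 2 * |l| * β)) n (hist z n ω)}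
      ≤ N * ENNReal.ofReal (Real.exp (-C)) := by
  set q := l ^ 2 / 2 + 2 * |l| * β with hq
  set G : ι → (t : ℕ) → (Fin t → Z) → Z → ℝ :=
    fun i t x y => l * (f i y - ∫ y', f i y' ∂κ t x) - q with hG
  have : Nonempty Ω := μ.nonempty_of_neZero
  have : Nonempty Z := this.map (z 0)
  have hGm : ∀ i t, Measurable (Function.uncurry (G i t)) := fun i t => by
    have h1 : Measurable fun x => ∫ y', f i y' ∂κ t x :=
      (StronglyMeasurable.integral_kernel (κ := κ t) (hfm i).stronglyMeasurable).measurable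
    exact ((((hfm i).comp measurable_snd).sub (h1.comp measurable_fst)).const_mul l).sub_const _
  set V := gameVal (symIncr f l) (symComp (Z := Z) q) with hV
  have hVm : ∀ r, Measurable (V r) := measurable_gameVal _ _
  -- The potential with `n - t` rounds to go: it starts at the value of the whole game from `0` and
  -- ends at the supremum of the exponentials.
  set Y : (t : ℕ) → (Fin t → Z) → ℝ≥0∞ :=
    fun t x => V (n - t) (fun i => selSum B (G i) t x) with hYdef
  have hY : ∀ t, Measurable (Y t) := fun t =>
    (hVm _).comp (measurable_pi_lambda _ fun i => measurable_selSum hB (hGm i) t)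
  have h := lintegral_hist_le μ hz hκ n hY (fun t ht x => by
    simp only [hYdef, selSum_snoc]
    obtain ⟨r, hr⟩ : ∃ r, n - t = r + 1 := ⟨n - t - 1, by omega⟩
    rw [hr, show n - (t + 1) = r by omega]
    by_cases hx : x ∈ B t
    · simp only [Set.indicator_of_mem hx]
      exact lintegral_gameVal_sym_le (κ t x) f hfm hf l q r _
    · simp only [Set.indicator_of_notMem hx, add_zero, lintegral_const, measure_univ, mul_one]
      exact gameVal_le_succ _ _ r none (by funext i; rfl) rfl _)
  have h0 : ENNReal.ofReal (Real.exp C) ≠ 0 := by simp [Real.exp_pos]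
  have hmk := mul_meas_ge_le_lintegral₀ (μ := μ)
    ((hY n).comp (measurable_hist hz n)).aemeasurable (ENNReal.ofReal (Real.exp C))
  have hle : ENNReal.ofReal (Real.exp C)
      * μ {ω | ∃ i, C ≤ selSum B (G i) n (hist z n ω)} ≤ N := by
    refine le_trans ?_ (hmk.trans (h.trans (gameVal_sym_le f hf hN)))
    gcongr
    rintro ⟨i, hi⟩
    refine (ENNReal.ofReal_le_ofReal (Real.exp_le_exp.2 hi)).trans ?_
    simp only [Function.comp, hYdef, hV, Nat.sub_self, gameVal, treeVal]
    -- At depth zero the value does not depend on the tree, so any tree will do.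
    refine le_trans (le_iSup (fun i => ENNReal.ofReal (Real.exp
      (selSum B (G i) n (hist z n ω)))) i) (le_iSup (fun _ : List Bool → Option (Z × Z) => ⨆ i,
        ENNReal.ofReal (Real.exp (selSum B (G i) n (hist z n ω)))) (fun _ => none))
  rw [Real.exp_neg, ENNReal.ofReal_inv_of_pos (Real.exp_pos _)]
  rwa [mul_comm, ← ENNReal.le_div_iff_mul_le (Or.inl h0) (Or.inl ENNReal.ofReal_ne_top),
    div_eq_mul_inv] at hle

end Supermartingale

/-! ### Combinatorics of the meta-algorithm -/

section Combinatorics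

variable {a : ℕ → ℕ → ℝ} {ε : ℝ}

theorem lt_of_mem_starts {t τ : ℕ} (h : τ ∈ starts a ε t) : τ < t := by
  induction t with
  | zero => simp [starts] at h
  | succ t ih =>
    rw [starts] at h
    split_ifs at h
    · exact (ih h).trans t.lt_succ_self
    · rcases List.mem_append.1 h with h | h
      · exact (ih h).trans t.lt_succ_self
      · rw [List.mem_singleton.1 h]; exact t.lt_succ_self

theorem starts_prefix {t t' : ℕ} (h : t ≤ t') : starts a ε t <+: starts a ε t' := by
  induction t', h using Nat.le_induction with
  | base => exact List.prefix_rfl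
  | succ t' _ ih =>
    rw [starts]
    split_ifs
    · exact ih
    · exact ih.trans (List.prefix_append _ _)

theorem mem_close {t j : ℕ} : j ∈ close a ε t ↔
    j < (starts a ε t).length ∧ a t ((starts a ε t).getD j 0) ≤ ε := by
  simp [close, numSub, dist]

theorem mem_updated {t j : ℕ} : j ∈ updated a ε t ↔ j ∈ close a ε t ∨
    (j = (starts a ε t).length ∧ ∀ τ ∈ starts a ε t, ¬ a t τ ≤ ε) := by
  have hcl : ¬ (close a ε t).Nonempty ↔ ∀ τ ∈ starts a ε t, ¬ a t τ ≤ ε := by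
    rw [Finset.not_nonempty_iff_eq_empty, Finset.eq_empty_iff_forall_notMem]
    constructor
    · intro h τ hτ hle
      obtain ⟨i, hi, rfl⟩ := List.getElem_of_mem hτ
      exact h i (mem_close.2 ⟨hi, by rwa [List.getD_eq_getElem _ _ hi]⟩)
    · intro h i hi
      obtain ⟨hi, hle⟩ := mem_close.1 hi
      rw [List.getD_eq_getElem _ _ hi] at hle
      exact h _ (List.getElem_mem hi) hle
  rw [← hcl, updated]
  split_ifs with h
  · simp [h]
  · rw [Finset.not_nonempty_iff_eq_empty] at h
    simp [h, numSub]

/-- The list of creation rounds only grows at its end, so the creation round of `j` can be read off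
at the later time `n`. The first alternative is the creation round itself, where no bound of `a t t`
by `ε` is available. -/
theorem start_of_mem_updated {t n j : ℕ} (htn : t < n) (h : j ∈ updated a ε t) :
    j < (starts a ε n).length ∧
      (t = (starts a ε n).getD j 0 ∨ a t ((starts a ε n).getD j 0) ≤ ε) := by
  rcases mem_updated.1 h with h | ⟨hj, hnew⟩
  · obtain ⟨hj, hle⟩ := mem_close.1 h
    obtain ⟨l, hl⟩ := starts_prefix (a := a) (ε := ε) htn.le
    rw [← hl, List.getD_append _ _ _ _ hj, List.length_append]
    exact ⟨by omega, Or.inr hle⟩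
  · obtain ⟨l, hl⟩ := starts_prefix (a := a) (ε := ε) (Nat.succ_le_of_lt htn)
    have hs : starts a ε (t + 1) = starts a ε t ++ [t] := by
      rw [starts, if_neg (by simpa using hnew)]
    have hj' : j < (starts a ε t ++ [t]).length := by simp [hj]
    rw [Nat.succ_eq_add_one, hs] at hl
    rw [← hl, List.getD_append _ _ _ _ hj', List.length_append]
    refine ⟨by omega, Or.inl ?_⟩
    rw [List.getD_eq_getElem _ _ hj']
    simp [hj]

theorem le_of_mem_updated {n j : ℕ} (h : j ∈ updated a ε n) (hj : j < (starts a ε n).length) :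
    a n ((starts a ε n).getD j 0) ≤ ε := by
  rcases mem_updated.1 h with h | ⟨h, -⟩
  · exact (mem_close.1 h).2
  · omega

open Classical in
theorem numUpd_eq_count (j n : ℕ) : numUpd a ε j n = Nat.count (fun t => j ∈ updated a ε t) n := by
  rw [Nat.count_eq_card_filter_range, numUpd]

end Combinatorics

/-! ### Passing between rounds and update numbers -/

theorem sum_range_ite_eq_sum_nth {R : Type*} [AddCommMonoid R] (p : ℕ → Prop) [DecidablePred p]
    (F : ℕ → ℕ → R) (n : ℕ) :
    ∑ t ∈ Finset.range n, (if p t then F (Nat.count p t) t else 0)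
      = ∑ i ∈ Finset.range (Nat.count p n), F i (Nat.nth p i) := by
  induction n with
  | zero => simp
  | succ n ih =>
    rw [Finset.sum_range_succ, ih, Nat.count_succ]
    split_ifs with h
    · rw [Finset.sum_range_succ, Nat.nth_count h]
    · simp

theorem exists_count_eq_of_lt_count {p : ℕ → Prop} [DecidablePred p] {n i : ℕ}
    (h : i < Nat.count p n) : ∃ s < n, p s ∧ Nat.count p s = i := by
  induction n with
  | zero => simp at h
  | succ n ih =>
    by_cases hi : i < Nat.count p n
    · obtain ⟨s, hs, h'⟩ := ih hi
      exact ⟨s, by omega, h'⟩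
    · rw [Nat.count_succ] at h
      split_ifs at h with hp
      · exact ⟨n, n.lt_succ_self, hp, by omega⟩
      · omega

theorem nth_mem_and_lt_of_lt_count {p : ℕ → Prop} [DecidablePred p] {n i : ℕ}
    (h : i < Nat.count p n) : p (Nat.nth p i) ∧ Nat.nth p i < n := by
  obtain ⟨s, hs, hps, rfl⟩ := exists_count_eq_of_lt_count h
  rw [Nat.nth_count hps]
  exact ⟨hps, hs⟩

/-- `Nat.nth` refers to the entire predicate, but a hit that occurs before `n` is determined by the
predicate below `n`. -/
theorem nth_congr_of_lt_count {p p' : ℕ → Prop} [DecidablePred p] [DecidablePred p'] {n i : ℕ}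
    (hp : ∀ s < n, p' s ↔ p s) (h : i < Nat.count p n) : Nat.nth p' i = Nat.nth p i := by
  obtain ⟨s, hs, hps, rfl⟩ := exists_count_eq_of_lt_count h
  have h1 : Nat.count p' s = Nat.count p s := by
    rw [Nat.count_eq_card_filter_range, Nat.count_eq_card_filter_range]
    congr 1
    exact Finset.filter_congr fun r hr => hp r ((Finset.mem_range.1 hr).trans hs)
  rw [Nat.nth_count hps, ← h1, Nat.nth_count ((hp s hs).2 hps)]

/-! ### Measurability of the selection -/

section Measurability

variable {Ω : Type*} {M : ℕ → ℕ → Ω → ℝ} {ε : ℝ}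

/-- There are countably many lists, so the recursion can be unfolded into countable Boolean
operations. Only the bounds `M p q` with `q < p < t` enter, which is what makes the selection
predictable. -/
theorem measurable_starts_eq {m : MeasurableSpace Ω} {t : ℕ}
    (hM : ∀ p < t, ∀ q < p, Measurable (M p q)) (L : List ℕ) :
    Measurable fun ω => starts (fun p q => M p q ω) ε t = L := by
  induction t generalizing L with
  | zero =>
    simp only [starts]
    exact measurable_const
  | succ t ih =>
    -- The quantifiers carry `τ < t` because the measurability of `M t τ` is available only there.
    have h1 : ∀ ω, (starts (fun p q => M p q ω) ε (t + 1) = L) =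
        ((starts (fun p q => M p q ω) ε t = L ∧ ∃ τ, ∃ _ : τ < t, τ ∈ L ∧ M t τ ω ≤ ε) ∨
        ∃ L', L' ++ [t] = L ∧ (starts (fun p q => M p q ω) ε t = L' ∧
          ∀ τ, ∀ _ : τ < t, τ ∈ L' → ¬ M t τ ω ≤ ε)) := by
      intro ω
      rw [starts]
      refine propext ?_
      split_ifs with h
      · constructor
        · rintro rfl
          obtain ⟨τ, hτ, hle⟩ := h
          exact Or.inl ⟨rfl, τ, lt_of_mem_starts hτ, hτ, hle⟩
        · rintro (⟨h, -⟩ | ⟨L', -, rfl, h'⟩)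
          · exact h
          · obtain ⟨τ, hτ, hle⟩ := h
            exact absurd hle (h' τ (lt_of_mem_starts hτ) hτ)
      · constructor
        · rintro rfl
          exact Or.inr ⟨_, rfl, rfl, fun τ _ hτ hle => h ⟨τ, hτ, hle⟩⟩
        · rintro (⟨rfl, τ, _, hτ, hle⟩ | ⟨L', rfl, rfl, h'⟩)
          · exact absurd ⟨τ, hτ, hle⟩ h
          · rfl
    simp only [h1]
    have h2 : ∀ τ < t, Measurable fun ω => M t τ ω ≤ ε := fun τ hτ =>
      measurableSet_setOfPred.1 (measurableSet_le (hM t t.lt_succ_self τ hτ) measurable_const)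
    have ih' := ih fun p hp => hM p (hp.trans t.lt_succ_self)
    refine ((ih' L).and (Measurable.exists fun τ => Measurable.exists fun hτ =>
      measurable_const.and (h2 τ hτ))).or (Measurable.exists fun L' => measurable_const.and
      ((ih' L').and (Measurable.forall fun τ => Measurable.forall fun hτ =>
        measurable_const.imp (h2 τ hτ).not)))

theorem measurable_mem_updated {m : MeasurableSpace Ω} {t : ℕ}
    (hM : ∀ p ≤ t, ∀ q < p, Measurable (M p q)) (j : ℕ) :
    Measurable fun ω => j ∈ updated (fun p q => M p q ω) ε t := by
  have h1 : ∀ ω, (j ∈ updated (fun p q => M p q ω) ε t) = ∃ L,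
      (starts (fun p q => M p q ω) ε t = L) ∧
      ((∃ τ, ∃ _ : τ < t, (τ = L.getD j 0 ∧ j < L.length) ∧ M t τ ω ≤ ε) ∨
        (j = L.length ∧ ∀ τ, ∀ _ : τ < t, τ ∈ L → ¬ M t τ ω ≤ ε)) := by
    intro ω
    refine propext (mem_updated.trans ?_)
    rw [mem_close]
    simp only [exists_eq_left']
    refine or_congr ⟨fun ⟨h, h'⟩ => ?_, fun ⟨τ, _, ⟨h1, h2⟩, h3⟩ => ⟨h2, h1 ▸ h3⟩⟩
      (and_congr_right fun _ => ⟨fun h τ _ hτ => h τ hτ,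
        fun h τ hτ => h τ (lt_of_mem_starts hτ) hτ⟩)
    refine ⟨_, ?_, ⟨rfl, h⟩, h'⟩
    rw [List.getD_eq_getElem _ _ h]
    exact lt_of_mem_starts (List.getElem_mem h)
  simp only [h1]
  have h2 : ∀ τ < t, Measurable fun ω => M t τ ω ≤ ε := fun τ hτ =>
    measurableSet_setOfPred.1 (measurableSet_le (hM t le_rfl τ hτ) measurable_const)
  exact Measurable.exists fun L => (measurable_starts_eq (fun p hp => hM p hp.le) L).and
    ((Measurable.exists fun τ => Measurable.exists fun hτ => measurable_const.and (h2 τ hτ)).or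
    (measurable_const.and (Measurable.forall fun τ => Measurable.forall fun hτ =>
        measurable_const.imp (h2 τ hτ).not)))

theorem comap_hist_mono {Z : Type*} [MeasurableSpace Z] (z : ℕ → Ω → Z) {s t : ℕ} (h : s ≤ t) :
    MeasurableSpace.comap (hist z s) MeasurableSpace.pi
      ≤ MeasurableSpace.comap (hist z t) MeasurableSpace.pi := by
  have : hist z s = (fun (x : Fin t → Z) (i : Fin s) => x (Fin.castLE h i)) ∘ hist z t := rfl
  rw [this, ← MeasurableSpace.comap_comp]
  exact MeasurableSpace.comap_mono (measurable_pi_lambda _ fun i =>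
    measurable_pi_apply _).comap_le

/-- An event in the σ-algebra generated by the history is a preimage under the history map. This
turns the update rule into sets of histories, as `selSum` requires. -/
theorem exists_selection {Z : Type*} [MeasurableSpace Z] {z : ℕ → Ω → Z}
    (hM : ∀ i j,
      Measurable[MeasurableSpace.comap (hist z (max i j)) MeasurableSpace.pi] (M i j)) (j : ℕ) :
    ∃ B : (t : ℕ) → Set (Fin t → Z), (∀ t, MeasurableSet (B t)) ∧
      ∀ t ω, hist z t ω ∈ B t ↔ j ∈ updated (fun p q => M p q ω) ε t := by
  have h : ∀ t, ∃ B : Set (Fin t → Z), MeasurableSet B ∧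
      ∀ ω, hist z t ω ∈ B ↔ j ∈ updated (fun p q => M p q ω) ε t := by
    intro t
    have h1 : MeasurableSet[MeasurableSpace.comap (hist z t) MeasurableSpace.pi]
        {ω | j ∈ updated (fun p q => M p q ω) ε t} := by
      refine @measurableSet_setOfPred _ (MeasurableSpace.comap (hist z t) MeasurableSpace.pi) _ |>.2
        (measurable_mem_updated (fun p hp q hq => (hM p q).mono (comap_hist_mono z ?_) le_rfl) j)
      omega
    obtain ⟨B, hB, hB'⟩ := h1
    exact ⟨B, hB, fun ω => Set.ext_iff.1 hB' ω⟩
  choose B hB hB' using h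
  exact ⟨B, hB, hB'⟩

end Measurability

/-! ### The hypotheses as functions of the history -/

section History

variable {Z V : Type*}

open Classical in
/-- The rounds before round `t` in which the history `x` is selected by `B`. -/
noncomputable def selected (B : (t : ℕ) → Set (Fin t → Z)) {t : ℕ} (x : Fin t → Z) : Finset ℕ :=
  {s ∈ Finset.range t | ∃ h : s < t, (fun i : Fin s => x (Fin.castLE h.le i)) ∈ B s}

/-- The hypothesis that the online algorithm `A` produces from the points of the history `x`
with indices in `S`; `y₀` is a default point. -/
noncomputable def hypOn (A : (i : ℕ) → (Fin i → Z) → Z → V) (y₀ : Z) {t : ℕ} (x : Fin t → Z)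
    (S : Finset ℕ) : Z → V :=
  A S.card fun l => if h : Nat.nth (fun s => s ∈ S) l < t then x ⟨_, h⟩ else y₀

/-- The number of arguments of `A` varies with the history, but the set of selected rounds takes
countably many values; for each fixed set the hypothesis is a measurable function of fixed
coordinates. -/
theorem measurable_loss_hypOn_selected [MeasurableSpace Z] [MeasurableSpace V]
    {B : (t : ℕ) → Set (Fin t → Z)} (hB : ∀ t, MeasurableSet (B t))
    {A : (i : ℕ) → (Fin i → Z) → Z → V} {D : Set V} {ℓ : V → Z → ℝ}
    (hℓ : Measurable (fun p : D × Z => ℓ (p.1 : V) p.2)) (hA : ∀ i x y, A i x y ∈ D)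
    (hAm : ∀ i, Measurable (fun p : (Fin i → Z) × Z => A i p.1 p.2)) (y₀ : Z) (t : ℕ) :
    Measurable fun p : (Fin t → Z) × Z => ℓ (hypOn A y₀ p.1 (selected B p.1) p.2) p.2 := by
  let _ : MeasurableSpace (Finset ℕ) := ⊤
  have h1 : Measurable fun x : Fin t → Z => selected B x := by
    refine measurable_to_countable' fun S => ?_
    have : (fun x : Fin t → Z => selected B x) ⁻¹' {S} = {x | ∀ s, ((s ∈ Finset.range t ∧
        ∃ h : s < t, (fun i : Fin s => x (Fin.castLE h.le i)) ∈ B s) ↔ s ∈ S)} := by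
      ext x
      simp [selected, Finset.ext_iff]
    rw [this]
    refine measurableSet_setOfPred.2 (Measurable.forall fun s => Measurable.iff
      (measurable_const.and (Measurable.exists fun h => ?_)) measurable_const)
    exact measurableSet_setOfPred.1 ((measurable_pi_lambda
      (fun (x : Fin t → Z) (i : Fin s) => x (Fin.castLE h.le i))
      fun i => measurable_pi_apply _) (hB s))
  have h2 : ∀ S : Finset ℕ, Measurable fun p : (Fin t → Z) × Z =>
      ℓ (hypOn A y₀ p.1 S p.2) p.2 := by
    intro S
    have hpt : ∀ l : Fin S.card, Measurable fun p : (Fin t → Z) × Z =>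
        if h : Nat.nth (fun s => s ∈ S) l < t then p.1 ⟨_, h⟩ else y₀ := by
      intro l
      by_cases h : Nat.nth (fun s => s ∈ S) l < t
      · simp only [dif_pos h]
        exact (measurable_pi_apply _).comp measurable_fst
      · simp only [dif_neg h]
        exact measurable_const
    have h3 : Measurable fun p : (Fin t → Z) × Z => hypOn A y₀ p.1 S p.2 := by
      exact (hAm S.card).comp ((measurable_pi_lambda _ hpt).prodMk measurable_snd)
    exact hℓ.comp ((h3.subtype_mk (h := fun p => hA _ _ _)).prodMk measurable_snd)
  exact (measurable_from_prod_countable_right (f := fun q : Finset ℕ × ((Fin t → Z) × Z) =>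
    ℓ (hypOn A y₀ q.2.1 q.1 q.2.2) q.2.2) h2).comp
    ((h1.comp measurable_fst).prodMk measurable_id)

theorem apply_congr_of_card_eq {W : Type*} (A : (i : ℕ) → (Fin i → Z) → W) {i i' : ℕ}
    (hi : i = i') {v v' : ℕ → Z} (h : ∀ l < i, v l = v' l) :
    A i (fun l => v l) = A i' (fun l => v' l) := by
  subst hi
  congr 1
  funext l
  exact h l l.2

theorem hypOn_selected_hist {Ω : Type*} {z : ℕ → Ω → Z} {M : ℕ → ℕ → Ω → ℝ} {ε : ℝ} {j : ℕ}
    {B : (t : ℕ) → Set (Fin t → Z)}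
    (hB : ∀ t ω, hist z t ω ∈ B t ↔ j ∈ updated (fun p q => M p q ω) ε t)
    (A : ℕ → (i : ℕ) → (Fin i → Z) → Z → V) (y₀ : Z) (t : ℕ) (ω : Ω) :
    hypOn (A j) y₀ (hist z t ω) (selected B (hist z t ω))
      = hyp A z M ε j (numUpd (fun p q => M p q ω) ε j t) ω := by
  classical
  have hsel : selected B (hist z t ω)
      = {s ∈ Finset.range t | j ∈ updated (fun p q => M p q ω) ε s} := by
    ext s
    simp only [selected, Finset.mem_filter, Finset.mem_range]
    refine and_congr_right fun hs => ?_
    rw [← hB s ω]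
    exact ⟨fun ⟨_, h⟩ => h, fun h => ⟨hs, h⟩⟩
  have hcard : (selected B (hist z t ω)).card = numUpd (fun p q => M p q ω) ε j t := by
    rw [hsel, numUpd]
  refine apply_congr_of_card_eq (A j) hcard (v := fun l =>
    if h : Nat.nth (fun s => s ∈ selected B (hist z t ω)) l < t then hist z t ω ⟨_, h⟩ else y₀)
    (v' := fun l => z (updTime (fun p q => M p q ω) ε j l) ω) fun l hl => ?_
  rw [hcard, numUpd_eq_count] at hl
  have h1 := nth_congr_of_lt_count (p := fun s => j ∈ updated (fun p q => M p q ω) ε s)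
    (p' := fun s => s ∈ selected B (hist z t ω)) (fun s hs => by simp [hsel, hs]) hl
  have h2 := (nth_mem_and_lt_of_lt_count hl).2
  -- The required update rounds all precede `t`, so the default `y₀` is never used.
  rw [dif_pos (by rw [h1]; exact h2)]
  simp only [hist, h1, updTime]

end History

/-! ### The excess risk of the output -/

/-- The deterministic core: each side of the comparison uses `α / 2 + 2 * ε`, one for the output and
one for the infimum. -/
theorem excess_le_of_deviation_le {𝓗 : Type*} [Nonempty 𝓗] (R : 𝓗 → ℝ) (P L : ℕ → 𝓗 → ℝ)
    (g : ℕ → 𝓗) (s : ℕ) (r α ε : ℝ) (hs : 1 ≤ s) (hR : ∀ h, R h ∈ Set.Icc (0 : ℝ) 1)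
    (hL : ∀ i h, L i h ∈ Set.Icc (0 : ℝ) 1) (hr : r ≤ (s : ℝ)⁻¹ * ∑ i ∈ Finset.Icc 1 s, R (g i))
    (hd : ∀ i < s, ∀ h, |R h - P i h| ≤ 2 * ε)
    (h₁ : ∑ i ∈ Finset.range s, (P i (g i) - L i (g i)) ≤ s * (α / 4))
    (h₂ : ∀ h, ∑ i ∈ Finset.range s, (L i h - P i h) ≤ s * (α / 2)) (hsα : 4 ≤ s * α) :
    r - ⨅ h, R h ≤ α + (∑ i ∈ Finset.range s, L i (g i)
      - ⨅ h, ∑ i ∈ Finset.range s, L i h) / s + 4 * ε := by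
  have hs0 : (0 : ℝ) < s := by exact_mod_cast hs
  -- The output averages hypotheses `1, …, s`, while the regret uses `0, …, s - 1`. The shift costs
  -- at most `1`, which `4 ≤ s * α` bounds by `s * (α / 4)`.
  have hsum : ∑ i ∈ Finset.Icc 1 s, R (g i) ≤ 1 + ∑ i ∈ Finset.range s, R (g i) := by
    have e1 : ∑ i ∈ Finset.Icc 1 s, R (g i) = ∑ i ∈ Finset.range s, R (g (i + 1)) := by
      rw [Finset.range_eq_Ico, Finset.sum_Ico_add' (fun i => R (g i)) 0 s 1]
      rfl
    have e2 := Finset.sum_range_succ' (fun i => R (g i)) s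
    rw [Finset.sum_range_succ] at e2
    linarith [(hR (g s)).2, (hR (g 0)).1]
  have hA : ∑ i ∈ Finset.range s, R (g i) ≤ ∑ i ∈ Finset.range s, (P i (g i) + 2 * ε) :=
    Finset.sum_le_sum fun i hi => by
      linarith [(abs_le.1 (hd i (Finset.mem_range.1 hi) (g i))).2]
  have hbdd : BddBelow (Set.range fun h => ∑ i ∈ Finset.range s, L i h) :=
    ⟨0, by rintro _ ⟨h, rfl⟩; exact Finset.sum_nonneg fun i _ => (hL i h).1⟩
  have hinf : ((⨅ h, ∑ i ∈ Finset.range s, L i h) - s * (α / 2) - s * (2 * ε)) / s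
      ≤ ⨅ h, R h := by
    refine le_ciInf fun h => ?_
    rw [div_le_iff₀ hs0]
    have hB : ∑ i ∈ Finset.range s, P i h ≤ ∑ i ∈ Finset.range s, (R h + 2 * ε) :=
      Finset.sum_le_sum fun i hi => by
        linarith [(abs_le.1 (hd i (Finset.mem_range.1 hi) h)).1]
    have hC := h₂ h
    rw [Finset.sum_sub_distrib] at hC
    simp only [Finset.sum_const, Finset.card_range, nsmul_eq_mul] at hB
    have := ciInf_le hbdd h
    nlinarith
  rw [Finset.sum_sub_distrib] at h₁
  rw [Finset.sum_add_distrib] at hA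
  simp only [Finset.sum_const, Finset.card_range, nsmul_eq_mul] at hA
  have hr' : r ≤ (∑ i ∈ Finset.range s, L i (g i) + s * (α / 2)
      + s * (2 * ε)) / s := by
    refine hr.trans ?_
    rw [inv_mul_eq_div]
    gcongr
    nlinarith
  have e1 : (⨅ h, ∑ i ∈ Finset.range s, L i h) / s - α / 2 - 2 * ε ≤ ⨅ h, R h := by
    refine le_trans (le_of_eq ?_) hinf
    field_simp
  have e2 : r ≤ (∑ i ∈ Finset.range s, L i (g i)) / s + α / 2 + 2 * ε := by
    refine hr'.trans (le_of_eq ?_)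
    field_simp
  rw [sub_div]
  linarith

section Risk

variable {Ω Z V : Type*} [MeasurableSpace Z]

theorem integral_mem_Icc (ν : Measure Z) [IsProbabilityMeasure ν] {f : Z → ℝ}
    (hfm : Measurable f) (hf : ∀ y, f y ∈ Set.Icc (0 : ℝ) 1) :
    ∫ y, f y ∂ν ∈ Set.Icc (0 : ℝ) 1 := by
  refine ⟨integral_nonneg fun y => (hf y).1, ?_⟩
  have h : ∫ y, f y ∂ν ≤ ∫ _, (1 : ℝ) ∂ν :=
    integral_mono (Integrable.of_mem_Icc 0 1 hfm.aemeasurable (ae_of_all _ hf))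
      (integrable_const _) fun y => (hf y).2
  simpa using h

theorem abs_risk_sub_le_discrepancy {ℓ : V → Z → ℝ} {H : Set (Z → V)} {z : ℕ → Ω → Z}
    {κ : (t : ℕ) → Kernel (Fin t → Z) Z} [∀ t, IsMarkovKernel (κ t)]
    (hm : ∀ h ∈ H, Measurable fun y => ℓ (h y) y)
    (h01 : ∀ h ∈ H, ∀ y, ℓ (h y) y ∈ Set.Icc (0 : ℝ) 1) (i j : ℕ) (ω : Ω) (h : H) :
    |risk ℓ z κ i h ω - risk ℓ z κ j h ω| ≤ discrepancy ℓ H z κ i j ω := by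
  refine le_ciSup (f := fun h : H => |risk ℓ z κ i h ω - risk ℓ z κ j h ω|) ⟨1, ?_⟩ h
  rintro _ ⟨h, rfl⟩
  have h1 := integral_mem_Icc (κ i (hist z i ω)) (hm h h.2) (h01 h h.2)
  have h2 := integral_mem_Icc (κ j (hist z j ω)) (hm h h.2) (h01 h h.2)
  simp only [risk, abs_le]
  constructor <;> linarith [h1.1, h1.2, h2.1, h2.2]

theorem integral_loss_average_le [AddCommGroup V] [Module ℝ V] (ν : Measure Z)
    [IsProbabilityMeasure ν] {D : Set V} {ℓ : V → Z → ℝ}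
    (h01 : ∀ d ∈ D, ∀ y, ℓ d y ∈ Set.Icc (0 : ℝ) 1)
    (hconv : ∀ y, ConvexOn ℝ D (fun d => ℓ d y)) {s : ℕ} (hs : 1 ≤ s) (g : ℕ → Z → V)
    (hgD : ∀ i y, g i y ∈ D) (hgm : ∀ i, Measurable fun y => ℓ (g i y) y) :
    ∫ y, ℓ (((s : ℝ)⁻¹ • ∑ i ∈ Finset.Icc 1 s, g i) y) y ∂ν
      ≤ (s : ℝ)⁻¹ * ∑ i ∈ Finset.Icc 1 s, ∫ y, ℓ (g i y) y ∂ν := by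
  have hs0 : (0 : ℝ) < s := by exact_mod_cast hs
  have hw : ∑ _i ∈ Finset.Icc 1 s, (s : ℝ)⁻¹ = 1 := by
    simp [hs0.ne']
  have heval : ∀ y, ((s : ℝ)⁻¹ • ∑ i ∈ Finset.Icc 1 s, g i) y
      = ∑ i ∈ Finset.Icc 1 s, (s : ℝ)⁻¹ • g i y := fun y => by
    rw [Pi.smul_apply, Finset.sum_apply, Finset.smul_sum]
  have hi : ∀ i, Integrable (fun y => ℓ (g i y) y) ν := fun i =>
    Integrable.of_mem_Icc 0 1 (hgm i).aemeasurable (ae_of_all _ fun y => h01 _ (hgD i y) y)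
  rw [Finset.mul_sum]
  simp only [heval, ← integral_const_mul]
  rw [← integral_finsetSum _ fun i _ => (hi i).const_mul _]
  -- Only the majorant has to be integrable, so measurability of the loss of the average is not an
  -- issue.
  refine integral_mono_of_nonneg (ae_of_all _ fun y => ?_)
    (integrable_finsetSum _ fun i _ => (hi i).const_mul _) (ae_of_all _ fun y => ?_)
  · exact (h01 _ ((hconv y).1.sum_mem (fun _ _ => inv_nonneg.2 hs0.le) hw
      fun i _ => hgD i y) y).1
  · exact (hconv y).map_sum_le (fun _ _ => inv_nonneg.2 hs0.le) hw fun i _ => hgD i y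

/-- Triangle inequality through the creation round of `j`, which is `ε`-close to both rounds. -/
theorem abs_risk_sub_le_of_mem_updated {ℓ : V → Z → ℝ} {H : Set (Z → V)} {z : ℕ → Ω → Z}
    {κ : (t : ℕ) → Kernel (Fin t → Z) Z} [∀ t, IsMarkovKernel (κ t)]
    (hm : ∀ h ∈ H, Measurable fun y => ℓ (h y) y)
    (h01 : ∀ h ∈ H, ∀ y, ℓ (h y) y ∈ Set.Icc (0 : ℝ) 1) {M : ℕ → ℕ → Ω → ℝ} {ε : ℝ}
    (hε : 0 ≤ ε) {ω : Ω} (hM : ∀ i j, discrepancy ℓ H z κ i j ω ≤ M i j ω) {j n t : ℕ}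
    (htn : t < n) (ht : j ∈ updated (fun p q => M p q ω) ε t)
    (hn : j ∈ updated (fun p q => M p q ω) ε n) (h : H) :
    |risk ℓ z κ n h ω - risk ℓ z κ t h ω| ≤ 2 * ε := by
  obtain ⟨hj, hτ⟩ := start_of_mem_updated htn ht
  have h1 := le_of_mem_updated hn hj
  generalize (starts (fun p q => M p q ω) ε n).getD j 0 = τ at *
  have h2 : |risk ℓ z κ n h ω - risk ℓ z κ τ h ω| ≤ ε :=
    ((abs_risk_sub_le_discrepancy hm h01 n τ ω h).trans (hM n τ)).trans h1
  have h3 : |risk ℓ z κ t h ω - risk ℓ z κ τ h ω| ≤ ε := by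
    rcases hτ with rfl | hτ
    · simpa using hε
    · exact ((abs_risk_sub_le_discrepancy hm h01 t τ ω h).trans (hM t τ)).trans hτ
  rw [abs_le] at *
  constructor <;> linarith [h2.1, h2.2, h3.1, h3.2]

end Risk

/-! ### Deviation of the losses of a subroutine from the conditional risks -/

section Deviation

variable {Ω Z V : Type*} [MeasurableSpace Ω] [MeasurableSpace Z] [MeasurableSpace V]
  (μ : Measure Ω) [IsProbabilityMeasure μ]
  {z : ℕ → Ω → Z} {κ : (t : ℕ) → Kernel (Fin t → Z) Z} [∀ t, IsMarkovKernel (κ t)]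
  {D : Set V} {ℓ : V → Z → ℝ} {M : ℕ → ℕ → Ω → ℝ}

theorem measure_hyp_deviation_le (hz : ∀ t, Measurable (z t))
    (hκ : ∀ t, HasCondDistrib (z t) (hist z t) (κ t) μ)
    (hℓ_meas : Measurable (fun p : D × Z => ℓ (p.1 : V) p.2))
    (hℓ_mem : ∀ d ∈ D, ∀ y, ℓ d y ∈ Set.Icc (0 : ℝ) 1)
    (hM_meas : ∀ i j,
      Measurable[MeasurableSpace.comap (hist z (max i j)) MeasurableSpace.pi] (M i j))
    (A : ℕ → (i : ℕ) → (Fin i → Z) → Z → V) (hA : ∀ j i x y, A j i x y ∈ D)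
    (hA_meas : ∀ j i, Measurable (fun p : (Fin i → Z) × Z => A j i p.1 p.2))
    (ε : ℝ) (n m : ℕ) {α : ℝ} (hα : 0 ≤ α) (j : ℕ) :
    μ {ω | m ≤ updates M ε j n ω ∧ updates M ε j n ω * (α / 4) <
      ∑ i ∈ Finset.range (updates M ε j n ω),
        (risk ℓ z κ (updTime (fun p q => M p q ω) ε j i) (hyp A z M ε j i ω) ω
          - ℓ (hyp A z M ε j i ω (z (updTime (fun p q => M p q ω) ε j i) ω))
              (z (updTime (fun p q => M p q ω) ε j i) ω))}
      ≤ ENNReal.ofReal (Real.exp (-(m * (α ^ 2 / 8)))) := by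
  classical
  obtain ⟨B, hBm, hB⟩ := exists_selection (ε := ε) hM_meas j
  have hΩ : Nonempty Ω := μ.nonempty_of_neZero
  obtain ⟨ω₀⟩ := hΩ
  set y₀ := z 0 ω₀
  -- The parameter `l = α` maximizes `l * α / 4 - l ^ 2 / 8`, with value `α ^ 2 / 8`.
  have key := measure_selSum_hoeffding_le μ hz hκ hBm
    (g := fun t x y => ℓ (hypOn (A j) y₀ x (selected B x) y) y)
    (measurable_loss_hypOn_selected hBm hℓ_meas (hA j) (hA_meas j) y₀)
    (fun t x y => hℓ_mem _ (hA _ _ _ _) y) α (m * (α ^ 2 / 8)) n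
  refine le_trans (measure_mono ?_) key
  rintro ω ⟨hm, hlt⟩
  simp only [Set.mem_ofPred_eq]
  rw [selSum_hist]
  simp only [hypOn_selected_hist hB, hB, numUpd_eq_count]
  rw [sum_range_ite_eq_sum_nth (fun t => j ∈ updated (fun p q => M p q ω) ε t)
    (fun i t => α * (∫ y', ℓ (hyp A z M ε j i ω y') y' ∂κ t (hist z t ω)
      - ℓ (hyp A z M ε j i ω (z t ω)) (z t ω)) - α ^ 2 / 8) n, ← numUpd_eq_count,
    Finset.sum_sub_distrib, ← Finset.mul_sum, Finset.sum_const, Finset.card_range, nsmul_eq_mul]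
  have hm' : (m : ℝ) ≤ numUpd (fun p q => M p q ω) ε j n := by exact_mod_cast hm
  have h1 := mul_le_mul_of_nonneg_left hlt.le hα
  have h2 := mul_le_mul_of_nonneg_right hm' (by positivity : 0 ≤ α ^ 2 / 8)
  refine h2.trans ?_
  have h3 : α * (updates M ε j n ω * (α / 4))
      = 2 * (updates M ε j n ω * (α ^ 2 / 8)) := by ring
  change (updates M ε j n ω : ℝ) * (α ^ 2 / 8) ≤ α * ∑ i ∈ Finset.range (updates M ε j n ω),
        (risk ℓ z κ (updTime (fun p q => M p q ω) ε j i) (hyp A z M ε j i ω) ω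
          - ℓ (hyp A z M ε j i ω (z (updTime (fun p q => M p q ω) ε j i) ω))
              (z (updTime (fun p q => M p q ω) ε j i) ω)) - updates M ε j n ω * (α ^ 2 / 8)
  linarith

omit [MeasurableSpace V] in
theorem measure_uniform_deviation_le {H : Set (Z → V)} (hz : ∀ t, Measurable (z t))
    (hκ : ∀ t, HasCondDistrib (z t) (hist z t) (κ t) μ)
    (hm : ∀ h ∈ H, Measurable fun y => ℓ (h y) y)
    (h01 : ∀ h ∈ H, ∀ y, ℓ (h y) y ∈ Set.Icc (0 : ℝ) 1)
    (hH_sep : PointwiseSeparable (lossClass ℓ H))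
    (hM_meas : ∀ i j,
      Measurable[MeasurableSpace.comap (hist z (max i j)) MeasurableSpace.pi] (M i j))
    (ε : ℝ) (n m N : ℕ) {α β : ℝ} (hβ : 0 ≤ β) (hc : 0 ≤ α / 2 - 4 * β)
    (hN : seqCoveringNumber (lossClass ℓ H) β n = N) (j : ℕ) :
    μ {ω | m ≤ updates M ε j n ω ∧ ∃ h ∈ H, updates M ε j n ω * (α / 2) <
      ∑ i ∈ Finset.range (updates M ε j n ω),
        (ℓ (h (z (updTime (fun p q => M p q ω) ε j i) ω))
              (z (updTime (fun p q => M p q ω) ε j i) ω)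
          - risk ℓ z κ (updTime (fun p q => M p q ω) ε j i) h ω)}
      ≤ N * ENNReal.ofReal (Real.exp (-(m * ((α / 2 - 4 * β) ^ 2 / 2)))) := by
  classical
  obtain ⟨B, hBm, hB⟩ := exists_selection (ε := ε) hM_meas j
  obtain ⟨F₀, hF₀, hcount, hdense⟩ := hH_sep
  have : Countable F₀ := hcount.to_subtype
  have hFm : ∀ f ∈ lossClass ℓ H, Measurable f := by
    rintro _ ⟨h, hh, rfl⟩; exact hm h hh
  have hF01 : ∀ f ∈ lossClass ℓ H, ∀ y, f y ∈ Set.Icc (0 : ℝ) 1 := by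
    rintro _ ⟨h, hh, rfl⟩; exact h01 h hh
  -- The gain per update is `l * α / 2 = l ^ 2 + 4 * l * β`; minus the compensator `l ^ 2 / 2 + 2 *
  -- l * β`, at least `l ^ 2 / 2` is left.
  set l := α / 2 - 4 * β with hl
  have key := measure_exists_selSum_le μ hz hκ hBm (fun f : F₀ => (f : Z → ℝ))
    (fun f => hFm f (hF₀ f.2)) (fun f => hF01 f (hF₀ f.2)) (β := β) (l := l) (n := n) (N := N)
    (fun x => by
      obtain ⟨C, hC, hcard⟩ := exists_finset_cover_of_seqCoveringNumber hN x
      refine ⟨C, fun f hf => hC f ?_, hcard⟩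
      obtain ⟨f, rfl⟩ := hf
      exact hF₀ f.2) (m * (l ^ 2 / 2))
  refine le_trans (measure_mono ?_) key
  rintro ω ⟨hms, h, hh, hlt⟩
  simp only [Set.mem_ofPred_eq]
  set s := updates M ε j n ω with hs
  set T := updTime (fun p q => M p q ω) ε j with hT
  -- The strict inequality is an open condition, so it passes from `h` to some member of the
  -- countable subclass; the risks converge by dominated convergence.
  obtain ⟨u, hu, hlim⟩ := hdense _ ⟨h, hh, rfl⟩
  have hint : ∀ t, Tendsto (fun k => ∫ y, u k y ∂κ t (hist z t ω)) atTop
      (𝓝 (risk ℓ z κ t h ω)) := fun t =>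
    tendsto_integral_of_dominated_convergence (fun _ => 1)
      (fun k => (hFm _ (hF₀ (hu k))).aestronglyMeasurable) (integrable_const _)
      (fun k => ae_of_all _ fun y => by
        have := hF01 _ (hF₀ (hu k)) y
        rw [Real.norm_eq_abs, abs_of_nonneg this.1]
        exact this.2) (ae_of_all _ hlim)
  have hlim' : Tendsto (fun k => ∑ i ∈ Finset.range s,
      (u k (z (T i) ω) - ∫ y, u k y ∂κ (T i) (hist z (T i) ω))) atTop
      (𝓝 (∑ i ∈ Finset.range s, (ℓ (h (z (T i) ω)) (z (T i) ω) - risk ℓ z κ (T i) h ω))) :=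
    tendsto_finsetSum _ fun i _ => (hlim _).sub (hint _)
  obtain ⟨k, hk⟩ := ((tendsto_order.1 hlim').1 _ hlt).exists
  refine ⟨⟨u k, hu k⟩, ?_⟩
  rw [selSum_hist]
  simp only [hB]
  rw [sum_range_ite_eq_sum_nth (fun t => j ∈ updated (fun p q => M p q ω) ε t)
    (fun _ t => l * (u k (z t ω) - ∫ y', u k y' ∂κ t (hist z t ω))
      - (l ^ 2 / 2 + 2 * |l| * β)) n, ← numUpd_eq_count,
    Finset.sum_sub_distrib, ← Finset.mul_sum, Finset.sum_const, Finset.card_range, nsmul_eq_mul,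
    abs_of_nonneg hc]
  have hm' : (m : ℝ) ≤ s := by exact_mod_cast hms
  have h1 := mul_le_mul_of_nonneg_left hk.le hc
  have h2 := mul_le_mul_of_nonneg_right hm' (by positivity : 0 ≤ l ^ 2 / 2)
  have h3 : 0 ≤ (s : ℝ) * (l * β) := by positivity
  refine h2.trans ?_
  change (s : ℝ) * (l ^ 2 / 2) ≤ l * ∑ i ∈ Finset.range s,
    (u k (z (T i) ω) - ∫ y, u k y ∂κ (T i) (hist z (T i) ω)) - s * (l ^ 2 / 2 + 2 * l * β)
  have h4 : l * (s * (α / 2)) = s * (l ^ 2) + 4 * (s * (l * β)) := by rw [hl]; ring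
  linarith

end Deviation

/-! ### Assembling the main theorem -/

theorem one_le_of_seqCoveringNumber_eq {Z : Type*} [Nonempty Z] {F : Set (Z → ℝ)}
    (hF : F.Nonempty) {θ : ℝ} {n N : ℕ} (h : seqCoveringNumber F θ n = N) : 1 ≤ N := by
  obtain ⟨C, hC, hcard⟩ := exists_finset_cover_of_seqCoveringNumber h
    (fun _ _ => Classical.arbitrary Z)
  obtain ⟨f, hf⟩ := hF
  obtain ⟨v, hv, -⟩ := hC f hf (fun _ => true)
  exact (Nat.succ_le_of_lt (Finset.card_pos.2 ⟨v, hv⟩)).trans hcard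

/-- The values outside the support are attained on a countable union of null sets. -/
theorem ae_mem_supp {Ω : Type*} [MeasurableSpace Ω] (μ : Measure Ω) (I : Ω → ℕ) :
    ∀ᵐ ω ∂μ, I ω ∈ supp μ I := by
  have h : ∀ᵐ ω ∂μ, ∀ j, I ω = j → j ∈ supp μ I := by
    refine ae_all_iff.2 fun j => ?_
    by_cases hj : j ∈ supp μ I
    · exact ae_of_all _ fun _ _ => hj
    · rw [ae_iff]
      simp only [hj, imp_false, not_not]
      simpa [supp] using hj
  filter_upwards [h] with ω hω using hω _ rfl

end Macro

theorem theorem2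
    {Ω Z V : Type*} [MeasurableSpace Ω] [MeasurableSpace Z]
    [AddCommGroup V] [Module ℝ V] [MeasurableSpace V] [MeasurableAdd₂ V] [MeasurableConstSMul ℝ V]
    -- the process and its conditional distributions
    (μ : Measure Ω) [IsProbabilityMeasure μ]
    (z : ℕ → Ω → Z) (hz : ∀ t, Measurable (z t))
    (κ : (t : ℕ) → Kernel (Fin t → Z) Z) [∀ t, IsMarkovKernel (κ t)]
    (hκ : ∀ t, HasCondDistrib (z t) (Macro.hist z t) (κ t) μ)
    -- the convex loss on the decision space `D`, with values in `[0, 1]`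
    (D : Set V) (ℓ : V → Z → ℝ)
    (hℓ_meas : Measurable (fun p : D × Z => ℓ (p.1 : V) p.2))
    (hℓ_mem : ∀ d ∈ D, ∀ y, ℓ d y ∈ Set.Icc (0 : ℝ) 1)
    (hℓ_conv : ∀ y, ConvexOn ℝ D (fun d => ℓ d y))
    -- the hypothesis class
    (H : Set (Z → V)) (hH : H.Nonempty) (hH_meas : ∀ h ∈ H, Measurable h)
    (hHD : ∀ h ∈ H, ∀ y, h y ∈ D)
    (hH_sep : Macro.PointwiseSeparable (Macro.lossClass ℓ H))
    -- observable upper bounds on the discrepancies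
    (M : ℕ → ℕ → Ω → ℝ)
    (hM_meas : ∀ i j,
      Measurable[MeasurableSpace.comap (Macro.hist z (max i j)) MeasurableSpace.pi] (M i j))
    (hM : ∀ i j, ∀ᵐ ω ∂μ, Macro.discrepancy ℓ H z κ i j ω ≤ M i j ω)
    -- the online subroutines
    (A : ℕ → (i : ℕ) → (Fin i → Z) → Z → V)
    (hA : ∀ j i x, A j i x ∈ H)
    (hA_meas : ∀ j i, Measurable (fun p : (Fin i → Z) × Z => A j i p.1 p.2))
    -- the threshold, and the index of the subroutine used after `n` observations
    (ε : ℝ) (hε : 0 ≤ ε) (n : ℕ)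
    (I : Ω → ℕ) (hI : ∀ ω, Macro.IsActive (fun p q => M p q ω) ε n (I ω))
    (k m : ℕ) (hk : 1 ≤ k) (hm : 1 ≤ m)
    (α β : ℝ) (hα : α ∈ Set.Icc (0 : ℝ) 1) (hβ : β ∈ Set.Icc 0 (α / 8)) :
    μ {ω | Macro.risk ℓ z κ n (Macro.avgHyp A z M ε (I ω) n ω) ω
            - ⨅ h : H, Macro.risk ℓ z κ n h ω
          > α + Macro.regret ℓ H A z M ε (I ω) n ω / Macro.updates M ε (I ω) n ω + 4 * ε}
      ≤ 4 * k * (Macro.seqCoveringNumber (Macro.lossClass ℓ H) β n : ℝ≥0∞)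
            / ENNReal.ofReal ((α / 2 - 4 * β) ^ 2)
          * ENNReal.ofReal (Real.exp (-(1 / 2) * m * (α / 2 - 4 * β) ^ 2))
        + μ (Macro.goodEvent μ M ε I n k m)ᶜ := by
  have hΩ : Nonempty Ω := μ.nonempty_of_neZero
  have hZ : Nonempty Z := hΩ.map (z 0)
  have hHne : Nonempty H := hH.to_subtype
  have hk0 : (k : ℝ≥0∞) ≠ 0 := by exact_mod_cast (by omega : k ≠ 0)
  have hlm : ∀ h ∈ H, Measurable fun y => ℓ (h y) y := fun h hh =>
    hℓ_meas.comp (((hH_meas h hh).subtype_mk (h := hHD h hh)).prodMk measurable_id)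
  have hl01 : ∀ h ∈ H, ∀ y, ℓ (h y) y ∈ Set.Icc (0 : ℝ) 1 := fun h hh y =>
    hℓ_mem _ (hHD h hh y) y
  have hexp : ENNReal.ofReal (Real.exp (-(1 / 2) * m * (α / 2 - 4 * β) ^ 2)) ≠ 0 := by
    simp [Real.exp_pos]
  rcases eq_or_ne (Macro.seqCoveringNumber (Macro.lossClass ℓ H) β n) ⊤ with hN | hN
  · rw [hN, ENat.toENNReal_top, ENNReal.mul_top (by simp [hk0]),
      ENNReal.top_div_of_ne_top ENNReal.ofReal_ne_top, ENNReal.top_mul hexp, top_add]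
    exact le_top
  obtain ⟨N, hN⟩ := ENat.ne_top_iff_exists.1 hN
  have hN := hN.symm
  -- Lets `N * E` dominate the Hoeffding bound, which carries no covering number.
  have hN1 : 1 ≤ N := Macro.one_le_of_seqCoveringNumber_eq (hH.image _) hN
  rw [hN, ENat.toENNReal_coe]
  have hN0 : (N : ℝ≥0∞) ≠ 0 := by exact_mod_cast (by omega : N ≠ 0)
  have hc0 : 0 ≤ α / 2 - 4 * β := by linarith [hβ.2]
  rcases hc0.eq_or_lt with hc | hc
  · rw [← hc, zero_pow two_ne_zero, ENNReal.ofReal_zero, ENNReal.div_zero (by simp [hk0, hN0]),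
      ENNReal.top_mul (by simp), top_add]
    exact le_top
  have hcα : α / 2 - 4 * β ≤ α / 2 := by linarith [hβ.1]
  have hα0 : 0 < α := by linarith
  set c := α / 2 - 4 * β with hcdef
  have hc12 : c ≤ 1 / 2 := by linarith [hα.2]
  set E := Real.exp (-(1 / 2) * m * c ^ 2) with hE
  have hE0 : 0 < E := Real.exp_pos _
  have hkR : (1 : ℝ) ≤ k := by exact_mod_cast hk
  have hNR : (1 : ℝ) ≤ N := by exact_mod_cast hN1
  have hrhs : 4 * (k : ℝ≥0∞) * N / ENNReal.ofReal (c ^ 2) * ENNReal.ofReal E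
      = ENNReal.ofReal (4 * k * N / c ^ 2 * E) := by
    rw [ENNReal.ofReal_mul (by positivity), ENNReal.ofReal_div_of_pos (by positivity),
      ENNReal.ofReal_mul (by positivity), ENNReal.ofReal_mul (by positivity)]
    simp
  rw [hrhs]
  -- Since `c ≤ 1 / 2`, the prefactor is at least `16 * k * N`; this absorbs all numerical constants
  -- below.
  have hc4 : (16 : ℝ) ≤ 4 / c ^ 2 := by
    rw [le_div_iff₀ (by positivity)]
    nlinarith
  have hbig : k * N * 16 * E ≤ 4 * k * N / c ^ 2 * E := by
    have : 4 * k * N / c ^ 2 * E = k * N * (4 / c ^ 2) * E := by ring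
    rw [this]
    gcongr
  have hkN : (1 : ℝ) ≤ k * N := by nlinarith
  -- With so few updates the index shift is unaffordable, but then `m * c ^ 2 ≤ 1`, hence `E ≥ 1 /
  -- 2` and the bound exceeds one.
  by_cases hmα : (m : ℝ) * α < 4
  · refine le_trans prob_le_one (le_trans ?_ le_self_add)
    rw [ENNReal.one_le_ofReal]
    refine le_trans ?_ hbig
    have h1 : (1 : ℝ) / 2 ≤ E := by
      have h2 : (m : ℝ) * c ^ 2 ≤ 1 := by
        have h3 : c ^ 2 ≤ α / 4 := by nlinarith [hα.2]
        nlinarith [mul_le_mul_of_nonneg_left h3 (Nat.cast_nonneg (α := ℝ) m)]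
      have h4 := Real.add_one_le_exp (-(1 / 2) * m * c ^ 2)
      linarith
    nlinarith
  push Not at hmα
  by_cases hcard : (Macro.supp μ I).encard ≤ k
  swap
  · have : Macro.goodEvent μ M ε I n k m = ∅ := by
      ext ω
      simp [Macro.goodEvent, hcard]
    rw [this, Set.compl_empty, measure_univ]
    exact prob_le_one.trans le_add_self
  have hfin : (Macro.supp μ I).Finite :=
    Set.encard_lt_top_iff.1 (hcard.trans_lt (ENat.natCast_lt_top k))
  have hcard' : hfin.toFinset.card ≤ k := by
    rw [hfin.encard_eq_coe_toFinset_card] at hcard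
    exact_mod_cast hcard
  set T := fun (ω : Ω) (j i : ℕ) => Macro.updTime (fun p q => M p q ω) ε j i with hT
  set bad₁ : ℕ → Set Ω := fun j => {ω | m ≤ Macro.updates M ε j n ω ∧
      Macro.updates M ε j n ω * (α / 4) < ∑ i ∈ Finset.range (Macro.updates M ε j n ω),
        (Macro.risk ℓ z κ (T ω j i) (Macro.hyp A z M ε j i ω) ω
          - ℓ (Macro.hyp A z M ε j i ω (z (T ω j i) ω)) (z (T ω j i) ω))} with hbad₁
  set bad₂ : ℕ → Set Ω := fun j => {ω | m ≤ Macro.updates M ε j n ω ∧ ∃ h ∈ H,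
      Macro.updates M ε j n ω * (α / 2) < ∑ i ∈ Finset.range (Macro.updates M ε j n ω),
        (ℓ (h (z (T ω j i) ω)) (z (T ω j i) ω) - Macro.risk ℓ z κ (T ω j i) h ω)} with hbad₂
  have hb₁ : ∀ j, μ (bad₁ j) ≤ ENNReal.ofReal (N * E) := fun j => by
    refine (Macro.measure_hyp_deviation_le μ hz hκ hℓ_meas hℓ_mem hM_meas A
      (fun j i x y => hHD _ (hA j i x) y) hA_meas ε n m hα.1 j).trans
      (ENNReal.ofReal_le_ofReal ?_)
    -- From `c ≤ α / 2` the Hoeffding exponent `α ^ 2 / 8` is at least `c ^ 2 / 2`.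
    refine le_trans (Real.exp_le_exp.2 ?_) (le_mul_of_one_le_left hE0.le hNR)
    have : c ^ 2 ≤ (α / 2) ^ 2 := by gcongr
    nlinarith [mul_le_mul_of_nonneg_left this (Nat.cast_nonneg (α := ℝ) m)]
  have hb₂ : ∀ j, μ (bad₂ j) ≤ ENNReal.ofReal (N * E) := fun j => by
    refine (Macro.measure_uniform_deviation_le μ hz hκ hlm hl01 hH_sep hM_meas ε n m N hβ.1
      hc0 hN j).trans (le_of_eq ?_)
    rw [ENNReal.ofReal_mul (Nat.cast_nonneg _), ENNReal.ofReal_natCast, hE]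
    congr 3
    ring
  have hae : ∀ᵐ ω ∂μ, ∀ i j, Macro.discrepancy ℓ H z κ i j ω ≤ M i j ω :=
    ae_all_iff.2 fun i => ae_all_iff.2 fun j => hM i j
  have hsub : {ω | Macro.risk ℓ z κ n (Macro.avgHyp A z M ε (I ω) n ω) ω
            - ⨅ h : H, Macro.risk ℓ z κ n h ω
          > α + Macro.regret ℓ H A z M ε (I ω) n ω / Macro.updates M ε (I ω) n ω + 4 * ε}
      ≤ᵐ[μ] ((⋃ j ∈ hfin.toFinset, (bad₁ j ∪ bad₂ j)) ∪ (Macro.goodEvent μ M ε I n k m)ᶜ : Set Ω)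
      := by
    filter_upwards [hae, Macro.ae_mem_supp μ I] with ω hdisc hsupp hbad
    by_contra hnot
    have hnot' : ω ∉ ((⋃ j ∈ hfin.toFinset, (bad₁ j ∪ bad₂ j))
      ∪ (Macro.goodEvent μ M ε I n k m)ᶜ : Set Ω) := hnot
    rw [Set.mem_union, not_or, Set.notMem_compl_iff] at hnot'
    obtain ⟨hnb, hgood⟩ := hnot'
    have hmem : I ω ∈ hfin.toFinset := hfin.mem_toFinset.2 hsupp
    have hn1 : ω ∉ bad₁ (I ω) := fun h => hnb (Set.mem_biUnion hmem (Or.inl h))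
    have hn2 : ω ∉ bad₂ (I ω) := fun h => hnb (Set.mem_biUnion hmem (Or.inr h))
    have hms := hgood.2 _ hsupp
    set j := I ω
    simp only [hbad₁, Set.mem_ofPred_eq, hms, true_and, not_lt] at hn1
    simp only [hbad₂, Set.mem_ofPred_eq, hms, true_and, not_exists, not_and, not_lt] at hn2
    have hup : j ∈ Macro.updated (fun p q => M p q ω) ε n := (hI ω).1
    have hs1 : 1 ≤ Macro.updates M ε j n ω := hm.trans hms
    have hfinal := Macro.excess_le_of_deviation_le (fun h : H => Macro.risk ℓ z κ n h ω)
      (fun i h => Macro.risk ℓ z κ (T ω j i) h ω)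
      (fun i h => ℓ ((h : Z → V) (z (T ω j i) ω)) (z (T ω j i) ω))
      (fun i => ⟨Macro.hyp A z M ε j i ω, hA _ _ _⟩) (Macro.updates M ε j n ω)
      (Macro.risk ℓ z κ n (Macro.avgHyp A z M ε j n ω) ω) α ε hs1
      (fun h => Macro.integral_mem_Icc _ (hlm h h.2) (hl01 h h.2))
      (fun i h => hl01 h h.2 _)
      (Macro.integral_loss_average_le _ hℓ_mem hℓ_conv hs1 (fun i => Macro.hyp A z M ε j i ω)
        (fun i y => hHD _ (hA _ _ _) y) (fun i => hlm _ (hA _ _ _)))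
      (fun i hi h => by
        classical
        rw [Macro.updates, Macro.numUpd_eq_count] at hi
        obtain ⟨h1, h2⟩ := Macro.nth_mem_and_lt_of_lt_count hi
        exact Macro.abs_risk_sub_le_of_mem_updated hlm hl01 hε hdisc h2 h1 hup h)
      hn1 (fun h => hn2 h h.2) (by
        refine hmα.trans ?_
        gcongr)
    exact absurd hbad (not_lt.2 hfinal)
  refine (measure_mono_ae hsub).trans ((measure_union_le _ _).trans ?_)
  gcongr
  refine (measure_biUnion_finset_le _ _).trans ?_
  calc ∑ j ∈ hfin.toFinset, μ (bad₁ j ∪ bad₂ j)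
      ≤ ∑ j ∈ hfin.toFinset, (ENNReal.ofReal (N * E) + ENNReal.ofReal (N * E)) :=
        Finset.sum_le_sum fun j _ => (measure_union_le _ _).trans (add_le_add (hb₁ j) (hb₂ j))
    _ = ENNReal.ofReal (hfin.toFinset.card * (N * E + N * E)) := by
        rw [Finset.sum_const, nsmul_eq_mul, ← ENNReal.ofReal_add (by positivity) (by positivity),
          ENNReal.ofReal_mul (Nat.cast_nonneg _), ENNReal.ofReal_natCast]
    _ ≤ ENNReal.ofReal (4 * k * N / c ^ 2 * E) := by
        -- The union bound produces only `2 * k * N * E`.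
        refine ENNReal.ofReal_le_ofReal (le_trans ?_ hbig)
        have h1 : (hfin.toFinset.card : ℝ) ≤ k := by exact_mod_cast hcard'
        have h2 : 0 ≤ (N : ℝ) * E := by positivity
        nlinarith [mul_le_mul_of_nonneg_right h1 h2, mul_nonneg (by linarith : (0:ℝ) ≤ k) h2]
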